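/- Let $\Sigma$ (element names), $\Gamma$ (attribute names) and $D$ (data values) be infinite sets. A tree $T$ is a finite unordered rooted tree whose nodes are labeled by elements of $\Sigma\uplus(\Gamma\times D)\uplus D$, where nodes with a label outside $\Sigma$ are leaves. Paths over $XP^{(/,//,*,[\,])}$ are given by $$p ::= \alpha::\psi \mid p/p' \mid p[q],\quad q ::= p \mid q\ \mathsf{and}\ q' \mid \mathsf{true},\quad \alpha ::= \mathsf{self}\mid\mathsf{child}\mid\mathsf{descendant},\quad \psi ::= l \mid *\quad (l\in\Sigma),$$ where $*$ matches exactly the labels in $\Sigma$; $[\![p]\!](T)$ is the set of nodes selected by $p$ from the root of $T$ under the usual semantics. $XP^{(/,*,[\,])}$ consists of the paths in which $\mathsf{descendant}$ does not occur (neither on the main path nor inside filters). An update capability over a class of paths is $U=\mathsf{insert}(p,\phi)$, $\mathsf{update}(p,\phi)$ or $\mathsf{delete}(p)$, with $p$ in that class and $\phi$ a node test: an $l\in\Sigma$, the wildcard $*$, an attribute name $f\in\Gamma$ (matching $\{f\}\times D$), or $\mathsf{text}()$ (matching $D$). On a tree $T$ it denotes the set $[\![U]\!](T)$ of atomic updates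 $\mathsf{insert}(n,T')$, $\mathsf{update}(n,T')$, respectively $\mathsf{delete}(n)$, with $n\in[\![p]\!](T)$ and, for insert and update, $T'$ a tree whose root label matches $\phi$; for a set $S$ of capabilities $[\![S]\!](T)=\bigcup_{U\in S}[\![U]\!](T)$. Let $\mathcal U(T)$ be the set of all atomic updates at nodes of $T$. A policy $\mathcal P=(ds,cr,\mathcal A,\mathcal D)$ consists of a default semantics and a conflict resolution $ds,cr\in\{+,-\}$ and of finite sets $\mathcal A,\mathcal D$ of allowed and denied capabilities, and $[\![\mathcal P]\!](T)$ is $$\mathcal U(T)\setminus([\![\mathcal D]\!](T)\setminus[\![\mathcal A]\!](T)),\quad [\![\mathcal A]\!](T),\quad \mathcal U(T)\setminus[\![\mathcal D]\!](T),\quad [\![\mathcal A]\!](T)\setminus[\![\mathcal D]\!](T)$$ for $(ds,cr)=(+,+),(-,+),(+,-),(-,-)$ respectively. $\mathcal P$ statically allows $U$ if $[\![U]\!](T)\subseteq[\![\mathcal P]\!](T)$ for every tree $T$. Let capabilities be written as strings over a finite alphabet in prefix notation, the names in $\Sigma$ and $\Gamma$ being written as binary words under arbitrary fixed injective codings. **Theorem.**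 For every fixed policy $\mathcal P$ over $XP^{(/,//,*,[\,])}$, the problem to decide, given an update capability $U$ over $XP^{(/,*,[\,])}$, whether $\mathcal P$ statically allows $U$, is solvable in polynomial time: there is a deterministic multi-stack (equivalently, multi-tape) Turing machine that decides it in a number of steps bounded by a polynomial in the length of the string that represents $U$. -/

import Mathlib

namespace XPathPolicy

/-! ### XML trees -/

/-- Node labels: element names, attribute-value pairs, data values. -/
inductive Label (Sig Gam D : Type) : Type
  | elem (l : Sig)
  | attr (f : Gam) (d : D)
  | data (d : D)

/-- Finite unordered unranked XML trees. The axioms say that `E` is the edge relation of a tree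
with root `root`; attribute nodes and data nodes are leaves. -/
structure XMLTree (Sig Gam D : Type) : Type 1 where
  V : Type
  finite_V : Finite V
  E : V → V → Prop
  root : V
  lab : V → Label Sig Gam D
  not_edge_root : ∀ v, ¬ E v root
  parent_unique : ∀ u v w, E u w → E v w → u = v
  reachable : ∀ v, Relation.ReflTransGen E root v
  leaf_of_not_elem : ∀ v, (∀ l, lab v ≠ Label.elem l) → ∀ w, ¬ E v w

/-! ### Downward XPath with child steps, descendant steps, wildcards and filters -/

/-- Node tests of path steps: an element name, or the wildcard. -/
inductive StepTest (Sig : Type) : Type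
  | name (l : Sig)
  | any

/-- All node tests: those of path steps, attribute names, and `text()`. -/
inductive NodeTest (Sig Gam : Type) : Type
  | elem (t : StepTest Sig)
  | attr (f : Gam)
  | text

inductive Axis : Type
  | self
  | child
  | descendant

mutual
/-- Path expressions `α::φ`, `p/p'`, `p[q]`. -/
inductive Path (Sig : Type) : Type
  | step (a : Axis) (t : StepTest Sig)
  | comp (p p' : Path Sig)
  | filter (p : Path Sig) (q : Filter Sig)

/-- Filters `p`, `q and q'`, `true`. -/
inductive Filter (Sig : Type) : Type
  | path (p : Path Sig)
  | conj (q q' : Filter Sig)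
  | tt
end

mutual
/-- The path has no descendant step, not even inside its filters. -/
def Path.DescendantFree {Sig : Type} : Path Sig → Prop
  | .step .self _ => True
  | .step .child _ => True
  | .step .descendant _ => False
  | .comp p p' => p.DescendantFree ∧ p'.DescendantFree
  | .filter p q => p.DescendantFree ∧ q.DescendantFree

def Filter.DescendantFree {Sig : Type} : Filter Sig → Prop
  | .path p => p.DescendantFree
  | .conj q q' => q.DescendantFree ∧ q'.DescendantFree
  | .tt => True
end

section Semantics

variable {Sig Gam D : Type}

/-- The set of labels matching a step test; the wildcard matches exactly the element names. -/
def StepTest.sem (Gam D : Type) : StepTest Sig → Set (Label Sig Gam D)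
  | .name l => {Label.elem l}
  | .any => Set.range Label.elem

/-- The set of labels matching a node test. -/
def NodeTest.sem (D : Type) : NodeTest Sig Gam → Set (Label Sig Gam D)
  | .elem t => t.sem Gam D
  | .attr f => Set.range (Label.attr f)
  | .text => Set.range Label.data

def Axis.rel (T : XMLTree Sig Gam D) : Axis → T.V → T.V → Prop
  | .self => fun v w => v = w
  | .child => T.E
  | .descendant => Relation.TransGen T.E

mutual
/-- `p.rel T v w`: evaluating `p` from the node `v` of `T` can reach `w`. -/
def Path.rel (T : XMLTree Sig Gam D) : Path Sig → T.V → T.V → Prop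
  | .step a t => fun v w => a.rel T v w ∧ T.lab w ∈ t.sem Gam D
  | .comp p p' => fun v w => ∃ x, p.rel T v x ∧ p'.rel T x w
  | .filter p q => fun v w => p.rel T v w ∧ q.holds T w

def Filter.holds (T : XMLTree Sig Gam D) : Filter Sig → T.V → Prop
  | .path p => fun v => ∃ w, p.rel T v w
  | .conj q q' => fun v => q.holds T v ∧ q'.holds T v
  | .tt => fun _ => True
end

/-- The nodes selected by `p` from the root of `T`. -/
def Path.eval (p : Path Sig) (T : XMLTree Sig Gam D) : Set T.V :=
  {v | p.rel T T.root v}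

end Semantics

/-! ### Atomic updates, update capabilities, policies -/

/-- Atomic updates applicable to the nodes of `T`: insert a copy of `T'` as a child of `n`,
replace `n` by `T'`, delete the subtree of `n`. -/
inductive AtomicUpdate {Sig Gam D : Type} (T : XMLTree Sig Gam D) : Type 1
  | insert (n : T.V) (T' : XMLTree Sig Gam D)
  | update (n : T.V) (T' : XMLTree Sig Gam D)
  | delete (n : T.V)

inductive Capability (Sig Gam : Type) : Type
  | insert (p : Path Sig) (φ : NodeTest Sig Gam)
  | update (p : Path Sig) (φ : NodeTest Sig Gam)
  | delete (p : Path Sig)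

/-- The path that characterizes the capability. -/
def Capability.path {Sig Gam : Type} : Capability Sig Gam → Path Sig
  | .insert p _ => p
  | .update p _ => p
  | .delete p => p

section PolicySemantics

variable {Sig Gam D : Type}

/-- The atomic updates on `T` described by a capability. -/
def Capability.sem (T : XMLTree Sig Gam D) : Capability Sig Gam → Set (AtomicUpdate T)
  | .insert p φ => {u | ∃ n T', u = .insert n T' ∧ n ∈ p.eval T ∧ T'.lab T'.root ∈ φ.sem D}
  | .update p φ => {u | ∃ n T', u = .update n T' ∧ n ∈ p.eval T ∧ T'.lab T'.root ∈ φ.sem D}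
  | .delete p => {u | ∃ n, u = .delete n ∧ n ∈ p.eval T}

inductive Effect : Type
  | allow
  | deny

/-- Access control policies: default semantics, conflict resolution, and finite sets of allowed and
of denied capabilities. -/
structure Policy (Sig Gam : Type) : Type where
  ds : Effect
  cr : Effect
  allowed : Finset (Capability Sig Gam)
  denied : Finset (Capability Sig Gam)

/-- The atomic updates on `T` described by some capability of a finite set. -/
def capsSem (S : Finset (Capability Sig Gam)) (T : XMLTree Sig Gam D) : Set (AtomicUpdate T) :=
  {u | ∃ U ∈ S, u ∈ U.sem T}

/-- The atomic updates on `T` that the policy allows. -/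
def Policy.sem (P : Policy Sig Gam) (T : XMLTree Sig Gam D) : Set (AtomicUpdate T) :=
  match P.ds, P.cr with
  | .allow, .allow => Set.univ \ (capsSem P.denied T \ capsSem P.allowed T)
  | .deny, .allow => capsSem P.allowed T
  | .allow, .deny => Set.univ \ capsSem P.denied T
  | .deny, .deny => capsSem P.allowed T \ capsSem P.denied T

/-- `U` is statically allowed by `P`: on every tree, `P` allows all updates described by `U`. -/
def Policy.StaticallyAllows (D : Type) (P : Policy Sig Gam) (U : Capability Sig Gam) : Prop :=
  ∀ T : XMLTree Sig Gam D, U.sem T ⊆ P.sem T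

end PolicySemantics

/-! ### Writing capabilities as strings

Capabilities are written in prefix notation over a finite alphabet. Names from the infinite alphabets
are written as binary words, between an opening symbol and the symbol `endName`. -/

inductive Token : Type
  | insert | update | delete
  | self | child | descendant
  | comp | filter
  | path | conj | tt
  | name | any | attr | text
  | bit (b : Bool) | endName
  deriving DecidableEq, Fintype

def nameTokens (w : List Bool) : List Token :=
  w.map Token.bit ++ [Token.endName]

def StepTest.tokens {Sig : Type} (c : Sig → List Bool) : StepTest Sig → List Token
  | .name l => .name :: nameTokens (c l)
  | .any => [.any]

def NodeTest.tokens {Sig Gam : Type} (c : Sig → List Bool) (c' : Gam → List Bool) :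
    NodeTest Sig Gam → List Token
  | .elem t => t.tokens c
  | .attr f => .attr :: nameTokens (c' f)
  | .text => [.text]

def Axis.token : Axis → Token
  | .self => .self
  | .child => .child
  | .descendant => .descendant

mutual
def Path.tokens {Sig : Type} (c : Sig → List Bool) : Path Sig → List Token
  | .step a t => a.token :: t.tokens c
  | .comp p p' => .comp :: (p.tokens c ++ p'.tokens c)
  | .filter p q => .filter :: (p.tokens c ++ q.tokens c)

def Filter.tokens {Sig : Type} (c : Sig → List Bool) : Filter Sig → List Token
  | .path p => .path :: p.tokens c
  | .conj q q' => .conj :: (q.tokens c ++ q'.tokens c)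
  | .tt => [.tt]
end

def Capability.tokens {Sig Gam : Type} (c : Sig → List Bool) (c' : Gam → List Bool) :
    Capability Sig Gam → List Token
  | .insert p φ => .insert :: (p.tokens c ++ φ.tokens c c')
  | .update p φ => .update :: (p.tokens c ++ φ.tokens c c')
  | .delete p => .delete :: p.tokens c

theorem nameTokens_inj (w w' : List Bool) (s s' : List Token)
    (h : nameTokens w ++ s = nameTokens w' ++ s') : w = w' ∧ s = s' := by
  induction w generalizing w' with
  | nil => cases w' <;> simp_all [nameTokens]
  | cons b w ih =>
    cases w' with
    | nil => simp [nameTokens] at h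
    | cons b' w' =>
      have := ih w'
      simp_all [nameTokens]

theorem StepTest.tokens_inj {Sig : Type} {c : Sig → List Bool} (hc : Function.Injective c)
    (t t' : StepTest Sig) (s s' : List Token) (h : t.tokens c ++ s = t'.tokens c ++ s') :
    t = t' ∧ s = s' := by
  cases t <;> cases t' <;> simp [StepTest.tokens] at h
  · have := nameTokens_inj _ _ _ _ h
    simpa [hc.eq_iff] using this
  · simpa using h

theorem NodeTest.tokens_inj {Sig Gam : Type} {c : Sig → List Bool} {c' : Gam → List Bool}
    (hc : Function.Injective c) (hc' : Function.Injective c') (t t' : NodeTest Sig Gam)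
    (h : t.tokens c c' = t'.tokens c c') : t = t' := by
  cases t with
  | elem t =>
    cases t' with
    | elem t' => simpa using (StepTest.tokens_inj hc t t' [] [] (by simpa [NodeTest.tokens] using h)).1
    | _ => cases t <;> simp [NodeTest.tokens, StepTest.tokens] at h
  | attr f =>
    cases t' with
    | elem t' => cases t' <;> simp [NodeTest.tokens, StepTest.tokens] at h
    | attr f' =>
      simp only [NodeTest.tokens, List.cons.injEq, true_and] at h
      have := (nameTokens_inj (c' f) (c' f') [] [] (by simpa using h)).1
      rw [hc' this]
    | text => simp [NodeTest.tokens] at h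
  | text =>
    cases t' with
    | elem t' => cases t' <;> simp [NodeTest.tokens, StepTest.tokens] at h
    | attr f' => simp [NodeTest.tokens] at h
    | text => rfl

mutual
theorem Path.tokens_inj {Sig : Type} {c : Sig → List Bool} (hc : Function.Injective c) :
    ∀ (p p' : Path Sig) (s s' : List Token), p.tokens c ++ s = p'.tokens c ++ s' → p = p' ∧ s = s'
  | .step a t, p', s, s', h => by
    cases p' with
    | step a' t' =>
      simp only [Path.tokens, List.cons_append, List.cons.injEq] at h
      obtain ⟨rfl, rfl⟩ := StepTest.tokens_inj hc t t' s s' h.2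
      cases a <;> cases a' <;> simp_all [Axis.token]
    | _ => cases a <;> simp [Path.tokens, Axis.token] at h
  | .comp p q, p', s, s', h => by
    cases p' with
    | step a' t' => cases a' <;> simp [Path.tokens, Axis.token] at h
    | comp p' q' =>
      simp only [Path.tokens, List.cons_append, List.append_assoc, List.cons.injEq, true_and] at h
      obtain ⟨rfl, h2⟩ := Path.tokens_inj hc p p' _ _ h
      obtain ⟨rfl, rfl⟩ := Path.tokens_inj hc q q' _ _ h2
      exact ⟨rfl, rfl⟩
    | filter p' q' => simp [Path.tokens] at h
  | .filter p q, p', s, s', h => by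
    cases p' with
    | step a' t' => cases a' <;> simp [Path.tokens, Axis.token] at h
    | comp p' q' => simp [Path.tokens] at h
    | filter p' q' =>
      simp only [Path.tokens, List.cons_append, List.append_assoc, List.cons.injEq, true_and] at h
      obtain ⟨rfl, h2⟩ := Path.tokens_inj hc p p' _ _ h
      obtain ⟨rfl, rfl⟩ := Filter.tokens_inj hc q q' _ _ h2
      exact ⟨rfl, rfl⟩

theorem Filter.tokens_inj {Sig : Type} {c : Sig → List Bool} (hc : Function.Injective c) :
    ∀ (q q' : Filter Sig) (s s' : List Token),
      q.tokens c ++ s = q'.tokens c ++ s' → q = q' ∧ s = s'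
  | .path p, q', s, s', h => by
    cases q' with
    | path p' =>
      simp only [Filter.tokens, List.cons_append, List.cons.injEq, true_and] at h
      obtain ⟨rfl, rfl⟩ := Path.tokens_inj hc p p' _ _ h
      exact ⟨rfl, rfl⟩
    | _ => simp [Filter.tokens] at h
  | .conj q r, q', s, s', h => by
    cases q' with
    | conj q' r' =>
      simp only [Filter.tokens, List.cons_append, List.append_assoc, List.cons.injEq, true_and] at h
      obtain ⟨rfl, h2⟩ := Filter.tokens_inj hc q q' _ _ h
      obtain ⟨rfl, rfl⟩ := Filter.tokens_inj hc r r' _ _ h2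
      exact ⟨rfl, rfl⟩
    | _ => simp [Filter.tokens] at h
  | .tt, q', s, s', h => by
    cases q' <;> simp_all [Filter.tokens]
end

theorem Capability.tokens_injective {Sig Gam : Type} {c : Sig → List Bool} {c' : Gam → List Bool}
    (hc : Function.Injective c) (hc' : Function.Injective c') :
    Function.Injective (Capability.tokens c c') := by
  intro U U' h
  cases U <;> cases U' <;> simp [Capability.tokens] at h
  · obtain ⟨rfl, h2⟩ := Path.tokens_inj hc _ _ _ _ h
    rw [NodeTest.tokens_inj hc hc' _ _ h2]
  · obtain ⟨rfl, h2⟩ := Path.tokens_inj hc _ _ _ _ h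
    rw [NodeTest.tokens_inj hc hc' _ _ h2]
  · rename_i p p'
    rw [(Path.tokens_inj hc p p' [] [] (by simpa using h)).1]

/-- The update capabilities whose path has child (and self) steps, wildcards and filters, but no
descendant steps. -/
abbrev ChildCapability (Sig Gam : Type) : Type :=
  {U : Capability Sig Gam // U.path.DescendantFree}

open Classical in
/-- The prefix notation of capabilities, for given binary codings of the element names and of the
attribute names. -/
noncomputable def capabilityEncoding {Sig Gam : Type} (eSig : Computability.Encoding Sig Bool)
    (eGam : Computability.Encoding Gam Bool) :
    Computability.Encoding (ChildCapability Sig Gam) Token where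
  encode U := U.1.tokens eSig.encode eGam.encode
  decode s :=
    if h : ∃ U : ChildCapability Sig Gam, U.1.tokens eSig.encode eGam.encode = s
    then some h.choose else none
  decode_encode U := by
    have h : ∃ U' : ChildCapability Sig Gam, U'.1.tokens eSig.encode eGam.encode =
        U.1.tokens eSig.encode eGam.encode := ⟨U, rfl⟩
    rw [dif_pos h]
    exact congrArg some (Subtype.ext
      (Capability.tokens_injective eSig.encode_injective eGam.encode_injective h.choose_spec))

/-! ### Polynomial time -/

/-- The decision problem `L` is solved by a Turing machine (with finitely many stacks as tapes) whose
number of steps is bounded by a polynomial in the length of the encoded instance. -/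
def DecidableInPolyTime {α A : Type} (e : Computability.Encoding α A) (L : α → Prop) : Prop :=
  ∃ f : α → Bool, (∀ a, f a = true ↔ L a) ∧
    Nonempty (Turing.TM2ComputableInPolyTime e.encode Computability.encodeBool f)

end XPathPolicy

-- Fix the policy. Each of its paths becomes a positive modal formula over trees with one marked
-- node, saying that the path selects the mark. Let `Φ` be a finite set containing these formulas
-- and closed under immediate subformulas. Whether the policy permits an atomic update at `n`
-- depends only on the kind and root label of the update and on the type of the root when `n` is
-- marked, that is, on the set of formulas of `Φ` true there. So `U` is statically allowed iff every
-- type in a certain set `R` is harmless for every action of `U`, where `R` consists of the root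
-- types of all marked trees in which the path of `U` selects the mark
-- (`Policy.staticallyAllows_iff`). `R` is one element of the finite domain `Set (Set Φ)`, which
-- does not depend on `U`; it remains to compute `R` from `U`.
--
-- Without descendant steps, a path is equivalent to a single tree pattern, or it demands two names
-- of one node and is unsatisfiable (`Path.sat_form_iff_exec`); in the latter case `U` is vacuously
-- allowed. For a pattern, `R` can be computed bottom-up (`reqTypes_cons`, `formTypes_frame`,
-- `markedTypes_frame_mark`, `markedTypes_frame_dia`). The type of an element node is a function of
-- its name, its mark and the union of the types of its children. The ingredients can be chosen
-- independently, since a tree can be grafted below a root and the root renamed without affecting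
-- what holds further down. Positivity enters because forgetting the mark can only shrink a type.
-- Names matter only up to finitely many classes: all words longer than every name in the policy
-- share one class.
--
-- Hence all operations act on fixed finite domains. They are hard-wired into the control of a stack
-- machine, so only their existence as functions is needed. The one unbounded kind of data on
-- pattern nodes is their names: `self` steps can test a node repeatedly, so an open pattern node
-- keeps its name on a stack, and a comparison is paid for by the input that it consumes. A
-- potential that drops at every step bounds the running time linearly
-- (`Conf.potential_lt_of_step`).

namespace XPathPolicy

/-! ### Modal formulas -/

/-- Positive modal formulas over marked trees; `dia` and `diaPlus` quantify over children and over
proper descendants. -/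
inductive Form (Sig : Type) : Type
  | test (t : StepTest Sig)
  | mark
  | tt
  | and (φ ψ : Form Sig)
  | dia (φ : Form Sig)
  | diaPlus (φ : Form Sig)

section

variable {Sig Gam D : Type}

def Form.sat (T : XMLTree Sig Gam D) (M : Set T.V) : Form Sig → T.V → Prop
  | .test t => fun v => T.lab v ∈ t.sem Gam D
  | .mark => fun v => v ∈ M
  | .tt => fun _ => True
  | .and φ ψ => fun v => φ.sat T M v ∧ ψ.sat T M v
  | .dia φ => fun v => ∃ w, T.E v w ∧ φ.sat T M w
  | .diaPlus φ => fun v => ∃ w, Relation.TransGen T.E v w ∧ φ.sat T M w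

mutual
/-- `p.form φ` says that `p` can reach a node that satisfies `φ`. -/
def Path.form : Path Sig → Form Sig → Form Sig
  | .step .self t, φ => .and (.test t) φ
  | .step .child t, φ => .dia (.and (.test t) φ)
  | .step .descendant t, φ => .diaPlus (.and (.test t) φ)
  | .comp p p', φ => p.form (p'.form φ)
  | .filter p q, φ => p.form (.and q.form φ)

def Filter.form : Filter Sig → Form Sig
  | .path p => p.form .tt
  | .conj q q' => .and q.form q'.form
  | .tt => .tt
end

mutual
-- The continuation `φ` is what makes composition and filters structural: they only prepend to what
-- must hold at the node reached.
theorem Path.sat_form (T : XMLTree Sig Gam D) (M : Set T.V) :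
    ∀ (p : Path Sig) (φ : Form Sig) (v : T.V),
      (p.form φ).sat T M v ↔ ∃ w, p.rel T v w ∧ φ.sat T M w
  | .step .self t, φ, v => by
    simp only [Path.form, Form.sat, Path.rel, Axis.rel]
    constructor
    · rintro ⟨h, h'⟩
      exact ⟨v, ⟨rfl, h⟩, h'⟩
    · rintro ⟨w, ⟨rfl, h⟩, h'⟩
      exact ⟨h, h'⟩
  | .step .child t, φ, v => by
    simp only [Path.form, Form.sat, Path.rel, Axis.rel, and_assoc]
  | .step .descendant t, φ, v => by
    simp only [Path.form, Form.sat, Path.rel, Axis.rel, and_assoc]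
  | .comp p p', φ, v => by
    rw [Path.form, Path.sat_form T M p]
    simp only [Path.sat_form T M p', Path.rel]
    constructor
    · rintro ⟨x, h, w, h', h''⟩
      exact ⟨w, ⟨x, h, h'⟩, h''⟩
    · rintro ⟨w, ⟨x, h, h'⟩, h''⟩
      exact ⟨x, h, w, h', h''⟩
  | .filter p q, φ, v => by
    rw [Path.form, Path.sat_form T M p]
    simp only [Form.sat, Filter.sat_form T M q, Path.rel, and_assoc]

theorem Filter.sat_form (T : XMLTree Sig Gam D) (M : Set T.V) :
    ∀ (q : Filter Sig) (v : T.V), q.form.sat T M v ↔ q.holds T v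
  | .path p, v => by
    rw [Filter.form, Path.sat_form T M p]
    simp only [Form.sat, and_true, Filter.holds]
  | .conj q q', v => by
    simp only [Filter.form, Form.sat, Filter.sat_form T M q, Filter.sat_form T M q', Filter.holds]
  | .tt, v => by simp only [Filter.form, Form.sat, Filter.holds]
end

theorem Path.mem_eval_iff (T : XMLTree Sig Gam D) (p : Path Sig) (n : T.V) :
    n ∈ p.eval T ↔ (p.form .mark).sat T {n} T.root := by
  rw [Path.sat_form]
  simp [Form.sat, Path.eval]

theorem Form.sat_mono (T : XMLTree Sig Gam D) {M M' : Set T.V} (h : M ⊆ M') :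
    ∀ (φ : Form Sig) (v : T.V), φ.sat T M v → φ.sat T M' v
  | .test _, _, hv => hv
  | .mark, _, hv => h hv
  | .tt, _, _ => trivial
  | .and φ ψ, v, hv => ⟨φ.sat_mono T h v hv.1, ψ.sat_mono T h v hv.2⟩
  | .dia φ, _, ⟨w, hw, hφ⟩ => ⟨w, hw, φ.sat_mono T h w hφ⟩
  | .diaPlus φ, _, ⟨w, hw, hφ⟩ => ⟨w, hw, φ.sat_mono T h w hφ⟩

/-- The mark does not occur. -/
def Form.MarkFree : Form Sig → Prop
  | .test _ => True
  | .mark => False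
  | .tt => True
  | .and φ ψ => φ.MarkFree ∧ ψ.MarkFree
  | .dia φ => φ.MarkFree
  | .diaPlus φ => φ.MarkFree

theorem Form.MarkFree.sat_iff (T : XMLTree Sig Gam D) (M M' : Set T.V) :
    ∀ {φ : Form Sig}, φ.MarkFree → ∀ v : T.V, φ.sat T M v ↔ φ.sat T M' v
  | .test _, _, _ => Iff.rfl
  | .tt, _, _ => Iff.rfl
  | .and φ ψ, h, v => by
    simp only [Form.sat, Form.MarkFree.sat_iff T M M' h.1, Form.MarkFree.sat_iff T M M' h.2]
  | .dia φ, h, v => by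
    simp only [Form.sat, Form.MarkFree.sat_iff (φ := φ) T M M' h]
  | .diaPlus φ, h, v => by
    simp only [Form.sat, Form.MarkFree.sat_iff (φ := φ) T M M' h]

/-- The mark occurs. -/
def Form.Marked : Form Sig → Prop
  | .test _ => False
  | .mark => True
  | .tt => False
  | .and φ ψ => φ.Marked ∨ ψ.Marked
  | .dia φ => φ.Marked
  | .diaPlus φ => φ.Marked

/-- Formulas are positive, without disjunction or negation, so an occurrence of the mark has to be
witnessed by a marked node below. -/
theorem Form.Marked.exists_mem (T : XMLTree Sig Gam D) (M : Set T.V) :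
    ∀ {φ : Form Sig}, φ.Marked → ∀ v : T.V, φ.sat T M v →
      ∃ n ∈ M, Relation.ReflTransGen T.E v n
  | .mark, _, v, hv => ⟨v, hv, .refl⟩
  | .and φ ψ, h, v, hv => by
    rcases h with h | h
    · exact h.exists_mem T M v hv.1
    · exact h.exists_mem T M v hv.2
  | .dia φ, h, v, ⟨w, hw, hφ⟩ => by
    obtain ⟨n, hn, hr⟩ := Form.Marked.exists_mem (φ := φ) T M h w hφ
    exact ⟨n, hn, .head hw hr⟩
  | .diaPlus φ, h, v, ⟨w, hw, hφ⟩ => by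
    obtain ⟨n, hn, hr⟩ := Form.Marked.exists_mem (φ := φ) T M h w hφ
    exact ⟨n, hn, hw.to_reflTransGen.trans hr⟩

/-! ### Satisfaction is preserved by bounded morphisms -/

theorem transGen_iff_of_bounded {V V' : Type} {E : V → V → Prop} {E' : V' → V' → Prop} (f : V → V')
    {S : Set V} (hS : ∀ v ∈ S, ∀ w, E v w → w ∈ S)
    (hE : ∀ v ∈ S, ∀ w', E' (f v) w' ↔ ∃ w, E v w ∧ f w = w') {v : V} (hv : v ∈ S) (w' : V') :
    Relation.TransGen E' (f v) w' ↔ ∃ w ∈ S, Relation.TransGen E v w ∧ f w = w' := by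
  constructor
  · intro h
    induction h with
    | single h =>
      obtain ⟨w, hw, rfl⟩ := (hE v hv _).1 h
      exact ⟨w, hS v hv w hw, .single hw, rfl⟩
    | tail _ h ih =>
      obtain ⟨w, hwS, hw, rfl⟩ := ih
      obtain ⟨x, hx, rfl⟩ := (hE w hwS _).1 h
      exact ⟨x, hS w hwS x hx, hw.tail hx, rfl⟩
  · rintro ⟨w, -, hw, rfl⟩
    have key : w ∈ S ∧ Relation.TransGen E' (f v) (f w) := by
      induction hw with
      | single h => exact ⟨hS v hv _ h, .single ((hE v hv _).2 ⟨_, h, rfl⟩)⟩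
      | tail _ h ih => exact ⟨hS _ ih.1 _ h, ih.2.tail ((hE _ ih.1 _).2 ⟨_, h, rfl⟩)⟩
    exact key.2

/-- Formulas look only downwards, so a back-and-forth condition on a set closed under children
suffices. Subtrees, grafting and relabelling are all instances; the root, which is nobody's child,
can be left out of `S`. -/
theorem Form.sat_iff_of_bounded {T T' : XMLTree Sig Gam D} {M : Set T.V} {M' : Set T'.V}
    (f : T.V → T'.V) {S : Set T.V} (hS : ∀ v ∈ S, ∀ w, T.E v w → w ∈ S)
    (hE : ∀ v ∈ S, ∀ w', T'.E (f v) w' ↔ ∃ w, T.E v w ∧ f w = w')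
    (hlab : ∀ v ∈ S, T'.lab (f v) = T.lab v) (hM : ∀ v ∈ S, f v ∈ M' ↔ v ∈ M) :
    ∀ (φ : Form Sig) {v : T.V}, v ∈ S → (φ.sat T' M' (f v) ↔ φ.sat T M v)
  | .test t, v, hv => by simp only [Form.sat, hlab v hv]
  | .mark, v, hv => hM v hv
  | .tt, _, _ => Iff.rfl
  | .and φ ψ, v, hv => by
    simp only [Form.sat, Form.sat_iff_of_bounded f hS hE hlab hM φ hv,
      Form.sat_iff_of_bounded f hS hE hlab hM ψ hv]
  | .dia φ, v, hv => by
    simp only [Form.sat]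
    constructor
    · rintro ⟨w', h, h'⟩
      obtain ⟨w, hw, rfl⟩ := (hE v hv w').1 h
      exact ⟨w, hw, (Form.sat_iff_of_bounded f hS hE hlab hM φ (hS v hv w hw)).1 h'⟩
    · rintro ⟨w, hw, h'⟩
      exact ⟨f w, (hE v hv _).2 ⟨w, hw, rfl⟩,
        (Form.sat_iff_of_bounded f hS hE hlab hM φ (hS v hv w hw)).2 h'⟩
  | .diaPlus φ, v, hv => by
    simp only [Form.sat]
    constructor
    · rintro ⟨w', h, h'⟩
      obtain ⟨w, hwS, hw, rfl⟩ := (transGen_iff_of_bounded f hS hE hv w').1 h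
      exact ⟨w, hw, (Form.sat_iff_of_bounded f hS hE hlab hM φ hwS).1 h'⟩
    · rintro ⟨w, hw, h'⟩
      have hwS : w ∈ S := by
        clear h'
        induction hw with
        | single h => exact hS v hv _ h
        | tail _ h ih => exact hS _ ih _ h
      exact ⟨f w, (transGen_iff_of_bounded f hS hE hv _).2 ⟨w, hwS, hw, rfl⟩,
        (Form.sat_iff_of_bounded f hS hE hlab hM φ hwS).2 h'⟩

theorem Form.sat_iff_of_marks {T : XMLTree Sig Gam D} {M M' : Set T.V} {v : T.V}
    (h : ∀ w, Relation.ReflTransGen T.E v w → (w ∈ M ↔ w ∈ M')) (φ : Form Sig) :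
    φ.sat T M v ↔ φ.sat T M' v :=
  Form.sat_iff_of_bounded (T := T) (T' := T) (M := M') (M' := M) id
    (S := {w | Relation.ReflTransGen T.E v w}) (fun _ hx _ hw => hx.tail hw)
    (fun _ _ _ => by simp) (fun _ _ => rfl) (fun x hx => h x hx) φ (v := v) .refl

/-! ### Surgery on trees -/

theorem XMLTree.not_transGen_root (T : XMLTree Sig Gam D) (v : T.V) :
    ¬ Relation.TransGen T.E v T.root := by
  intro h
  rcases Relation.TransGen.tail'_iff.1 h with ⟨w, -, hw⟩
  exact T.not_edge_root w hw

theorem XMLTree.ne_root_of_edge (T : XMLTree Sig Gam D) {v w : T.V} (h : T.E v w) : w ≠ T.root := by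
  rintro rfl
  exact T.not_edge_root v h

theorem XMLTree.not_transGen_self (T : XMLTree Sig Gam D) (v : T.V) :
    ¬ Relation.TransGen T.E v v := by
  have h := T.reachable v
  induction h with
  | refl => exact T.not_transGen_root _
  | tail h e ih =>
    intro hc
    obtain ⟨x, hx, hx'⟩ := Relation.TransGen.tail'_iff.1 hc
    obtain rfl := T.parent_unique _ _ _ e hx'
    exact ih (Relation.TransGen.head' e hx)

/-- Two ancestors of `n` are comparable, and distinct siblings are not. This isolates the one child
whose subtree contains the mark. -/
theorem XMLTree.child_unique (T : XMLTree Sig Gam D) {v c c' n : T.V} (hc : T.E v c)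
    (hc' : T.E v c') (h : Relation.ReflTransGen T.E c n) (h' : Relation.ReflTransGen T.E c' n) :
    c = c' := by
  induction h with
  | refl =>
    rcases h'.cases_tail with h' | ⟨x, hx, hx'⟩
    · exact h'
    · obtain rfl := T.parent_unique _ _ _ hc hx'
      exact absurd (Relation.TransGen.head' hc' hx) (T.not_transGen_self _)
  | tail h e ih =>
    rcases h'.cases_tail with rfl | ⟨x, hx, hx'⟩
    · obtain rfl := T.parent_unique _ _ _ hc' e
      exact absurd (Relation.TransGen.head' hc h) (T.not_transGen_self _)
    · obtain rfl := T.parent_unique _ _ _ e hx'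
      exact ih hx

theorem XMLTree.elem_of_edge (T : XMLTree Sig Gam D) {v w : T.V} (h : T.E v w) :
    ∃ l, T.lab v = .elem l := by
  by_contra hn
  push Not at hn
  exact T.leaf_of_not_elem v hn w h

/-- The subtree of a node. -/
def XMLTree.subtree (T : XMLTree Sig Gam D) (v : T.V) : XMLTree Sig Gam D where
  V := {w : T.V // Relation.ReflTransGen T.E v w}
  finite_V := have := T.finite_V; inferInstance
  E x y := T.E x.1 y.1
  root := ⟨v, .refl⟩
  lab x := T.lab x.1
  not_edge_root x h := T.not_transGen_self v (Relation.TransGen.tail' x.2 h)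
  parent_unique x y z h h' := Subtype.ext (T.parent_unique _ _ _ h h')
  reachable := by
    rintro ⟨w, h⟩
    induction h with
    | refl => exact .refl
    | tail h e ih => exact ih.tail e
  leaf_of_not_elem x h y := T.leaf_of_not_elem x.1 h y.1

theorem XMLTree.sat_subtree (T : XMLTree Sig Gam D) (v : T.V) (M : Set T.V) (φ : Form Sig) :
    φ.sat (T.subtree v) {x | x.1 ∈ M} (T.subtree v).root ↔ φ.sat T M v :=
  (Form.sat_iff_of_bounded (T := T.subtree v) (T' := T) (fun x => x.1) (S := Set.univ)
    (fun _ _ _ _ => trivial)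
    (fun x _ w' => ⟨fun h => ⟨⟨w', x.2.tail h⟩, h, rfl⟩, by rintro ⟨w, h, rfl⟩; exact h⟩)
    (fun _ _ => rfl) (fun _ _ => Iff.rfl) φ (v := (T.subtree v).root) trivial).symm

open Classical in
/-- The tree with another element name at the root. -/
noncomputable def XMLTree.relabel (T : XMLTree Sig Gam D) (l : Sig) : XMLTree Sig Gam D where
  V := T.V
  finite_V := T.finite_V
  E := T.E
  root := T.root
  lab v := if v = T.root then .elem l else T.lab v
  not_edge_root := T.not_edge_root
  parent_unique := T.parent_unique
  reachable := T.reachable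
  leaf_of_not_elem v h w := by
    by_cases hv : v = T.root
    · simp [hv] at h
    · exact T.leaf_of_not_elem v (by simpa [hv] using h) w

theorem XMLTree.lab_relabel (T : XMLTree Sig Gam D) (l : Sig) :
    (T.relabel l).lab T.root = .elem l := by
  simp [XMLTree.relabel]

theorem XMLTree.sat_relabel (T : XMLTree Sig Gam D) (l : Sig) {M M' : Set T.V}
    (h : ∀ v, v ≠ T.root → (v ∈ M ↔ v ∈ M')) {v : T.V} (hv : v ≠ T.root) (φ : Form Sig) :
    φ.sat (T.relabel l) M v ↔ φ.sat T M' v :=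
  Form.sat_iff_of_bounded (T := T) (T' := T.relabel l) (M := M') (M' := M) id
    (S := {v | v ≠ T.root}) (fun _ _ _ hw => T.ne_root_of_edge hw)
    (fun _ _ w' => ⟨fun h => ⟨w', h, rfl⟩, fun ⟨_, h, h'⟩ => h' ▸ h⟩) (fun _ hv => if_neg hv) h φ hv

/-- The edges of the tree that arises from adding a tree as a child of the root of another one. -/
def XMLTree.graftEdge (T T' : XMLTree Sig Gam D) : T.V ⊕ T'.V → T.V ⊕ T'.V → Prop
  | .inl v, .inl w => T.E v w
  | .inl v, .inr w => v = T.root ∧ w = T'.root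
  | .inr v, .inr w => T'.E v w
  | .inr _, .inl _ => False

/-- The tree with another tree added as a child of the root. -/
def XMLTree.graft (T : XMLTree Sig Gam D) (hT : ∃ l, T.lab T.root = .elem l)
    (T' : XMLTree Sig Gam D) : XMLTree Sig Gam D where
  V := T.V ⊕ T'.V
  finite_V := have := T.finite_V; have := T'.finite_V; inferInstance
  E := T.graftEdge T'
  root := .inl T.root
  lab := Sum.elim T.lab T'.lab
  not_edge_root
    | .inl v => T.not_edge_root v
    | .inr _ => id
  parent_unique
    | .inl u, .inl v, .inl w, h, h' => congrArg _ (T.parent_unique u v w h h')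
    | .inl u, .inl v, .inr w, h, h' => congrArg _ (h.1.trans h'.1.symm)
    | .inr u, .inr v, .inr w, h, h' => congrArg _ (T'.parent_unique u v w h h')
    | .inl u, .inr v, .inr w, h, h' => by
      obtain ⟨-, rfl⟩ := h
      exact absurd h' (T'.not_edge_root v)
    | .inr u, .inl v, .inr w, h, h' => by
      obtain ⟨-, rfl⟩ := h'
      exact absurd h (T'.not_edge_root u)
  reachable
    | .inl v => Relation.ReflTransGen.lift (p := T.graftEdge T') Sum.inl (fun _ _ h => h) _ _
        (T.reachable v)
    | .inr v => .head (b := .inr T'.root) (show T.graftEdge T' (.inl T.root) (.inr T'.root) from ⟨rfl, rfl⟩)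
        (Relation.ReflTransGen.lift (p := T.graftEdge T') Sum.inr (fun _ _ h => h) _ _
          (T'.reachable v))
  leaf_of_not_elem
    | .inl v, h, .inl w => T.leaf_of_not_elem v h w
    | .inl v, h, .inr w => by
      rintro ⟨rfl, -⟩
      obtain ⟨l, hl⟩ := hT
      exact h l hl
    | .inr v, h, .inr w => T'.leaf_of_not_elem v h w
    | .inr v, _, .inl w => id

section

variable (T : XMLTree Sig Gam D) (hT : ∃ l, T.lab T.root = .elem l) (T' : XMLTree Sig Gam D)

def XMLTree.graftInl : T.V → (T.graft hT T').V := Sum.inl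

def XMLTree.graftInr : T'.V → (T.graft hT T').V := Sum.inr

theorem XMLTree.graft_edge_inl {v : T.V} (hv : v ≠ T.root) (w : (T.graft hT T').V) :
    (T.graft hT T').E (T.graftInl hT T' v) w ↔ ∃ w', T.E v w' ∧ T.graftInl hT T' w' = w := by
  rcases w with w | w
  · exact ⟨fun h => ⟨w, h, rfl⟩, by rintro ⟨w', h, h'⟩; exact Sum.inl_injective h' ▸ h⟩
  · exact ⟨fun h => absurd h.1 hv, by rintro ⟨w', h, h'⟩; exact absurd h' Sum.inl_ne_inr⟩

theorem XMLTree.graft_edge_inr (v : T'.V) (w : (T.graft hT T').V) :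
    (T.graft hT T').E (T.graftInr hT T' v) w ↔ ∃ w', T'.E v w' ∧ T.graftInr hT T' w' = w := by
  rcases w with w | w
  · exact ⟨fun h => h.elim, by rintro ⟨w', h, h'⟩; exact absurd h' Sum.inr_ne_inl⟩
  · exact ⟨fun h => ⟨w, h, rfl⟩, by rintro ⟨w', h, h'⟩; exact Sum.inr_injective h' ▸ h⟩

theorem XMLTree.graft_edge_root (w : (T.graft hT T').V) :
    (T.graft hT T').E (T.graft hT T').root w ↔
      (∃ w', T.E T.root w' ∧ w = T.graftInl hT T' w') ∨ w = T.graftInr hT T' T'.root := by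
  rcases w with w | w
  · constructor
    · exact fun h => .inl ⟨w, h, rfl⟩
    · rintro (⟨w', h, h'⟩ | h)
      · exact Sum.inl_injective h' ▸ h
      · exact absurd h Sum.inl_ne_inr
  · constructor
    · exact fun h => .inr (congrArg Sum.inr h.2)
    · rintro (⟨w', h, h'⟩ | h)
      · exact absurd h' Sum.inr_ne_inl
      · exact ⟨rfl, Sum.inr_injective h⟩

theorem XMLTree.sat_graftInl (M : Set (T.graft hT T').V) {v : T.V} (hv : v ≠ T.root)
    (φ : Form Sig) :
    φ.sat (T.graft hT T') M (T.graftInl hT T' v) ↔ φ.sat T (T.graftInl hT T' ⁻¹' M) v :=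
  Form.sat_iff_of_bounded (T.graftInl hT T') (S := {v | v ≠ T.root})
    (fun _ _ _ hw => T.ne_root_of_edge hw) (fun _ hv w' => T.graft_edge_inl hT T' hv w')
    (fun _ _ => rfl) (fun _ _ => Iff.rfl) φ hv

theorem XMLTree.sat_graftInr (M : Set (T.graft hT T').V) (v : T'.V) (φ : Form Sig) :
    φ.sat (T.graft hT T') M (T.graftInr hT T' v) ↔ φ.sat T' (T.graftInr hT T' ⁻¹' M) v :=
  Form.sat_iff_of_bounded (T.graftInr hT T') (S := Set.univ)
    (fun _ _ _ _ => trivial) (fun v _ w' => T.graft_edge_inr hT T' v w')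
    (fun _ _ => rfl) (fun _ _ => Iff.rfl) φ trivial

end

end

/-! ### Types of nodes over a closed set of formulas -/

/-- Closure under immediate subformulas. -/
structure FormsClosed {Sig : Type} (Φ : Set (Form Sig)) : Prop where
  and_left : ∀ {φ ψ : Form Sig}, .and φ ψ ∈ Φ → φ ∈ Φ
  and_right : ∀ {φ ψ : Form Sig}, .and φ ψ ∈ Φ → ψ ∈ Φ
  dia : ∀ {φ : Form Sig}, .dia φ ∈ Φ → φ ∈ Φ
  diaPlus : ∀ {φ : Form Sig}, .diaPlus φ ∈ Φ → φ ∈ Φ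

section

variable {Sig Gam D : Type}

def Form.subforms : Form Sig → Set (Form Sig)
  | .test t => {.test t}
  | .mark => {.mark}
  | .tt => {.tt}
  | .and φ ψ => insert (.and φ ψ) (φ.subforms ∪ ψ.subforms)
  | .dia φ => insert (.dia φ) φ.subforms
  | .diaPlus φ => insert (.diaPlus φ) φ.subforms

theorem Form.mem_subforms_self (φ : Form Sig) : φ ∈ φ.subforms := by
  cases φ <;> simp [Form.subforms]

theorem Form.finite_subforms : ∀ φ : Form Sig, φ.subforms.Finite
  | .test _ => Set.finite_singleton _
  | .mark => Set.finite_singleton _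
  | .tt => Set.finite_singleton _
  | .and φ ψ => (φ.finite_subforms.union ψ.finite_subforms).insert _
  | .dia φ => φ.finite_subforms.insert _
  | .diaPlus φ => φ.finite_subforms.insert _

theorem Form.formsClosed_subforms (φ : Form Sig) : FormsClosed φ.subforms := by
  induction φ with
  | test t => constructor <;> simp [Form.subforms]
  | mark => constructor <;> simp [Form.subforms]
  | tt => constructor <;> simp [Form.subforms]
  | and φ ψ h h' =>
    constructor
    · rintro a b (e | e | e)
      · cases e; exact .inr (.inl φ.mem_subforms_self)
      · exact .inr (.inl (h.and_left e))
      · exact .inr (.inr (h'.and_left e))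
    · rintro a b (e | e | e)
      · cases e; exact .inr (.inr ψ.mem_subforms_self)
      · exact .inr (.inl (h.and_right e))
      · exact .inr (.inr (h'.and_right e))
    · rintro a (e | e | e)
      · cases e
      · exact .inr (.inl (h.dia e))
      · exact .inr (.inr (h'.dia e))
    · rintro a (e | e | e)
      · cases e
      · exact .inr (.inl (h.diaPlus e))
      · exact .inr (.inr (h'.diaPlus e))
  | dia φ h =>
    constructor
    · rintro a b (e | e)
      · cases e
      · exact .inr (h.and_left e)
    · rintro a b (e | e)
      · cases e
      · exact .inr (h.and_right e)
    · rintro a (e | e)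
      · cases e; exact .inr φ.mem_subforms_self
      · exact .inr (h.dia e)
    · rintro a (e | e)
      · cases e
      · exact .inr (h.diaPlus e)
  | diaPlus φ h =>
    constructor
    · rintro a b (e | e)
      · cases e
      · exact .inr (h.and_left e)
    · rintro a b (e | e)
      · cases e
      · exact .inr (h.and_right e)
    · rintro a (e | e)
      · cases e
      · exact .inr (h.dia e)
    · rintro a (e | e)
      · cases e; exact .inr φ.mem_subforms_self
      · exact .inr (h.diaPlus e)

/-- Finiteness of the closure makes the set of types finite, and with it the control of the machine.
-/
theorem exists_finite_formsClosed (S : Set (Form Sig)) (hS : S.Finite) :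
    ∃ Φ : Set (Form Sig), S ⊆ Φ ∧ Φ.Finite ∧ FormsClosed Φ := by
  refine ⟨⋃ φ ∈ S, φ.subforms, fun φ h => Set.mem_biUnion h φ.mem_subforms_self,
    hS.biUnion fun φ _ => φ.finite_subforms, ?_⟩
  constructor <;> simp only [Set.mem_iUnion, exists_prop]
  · rintro _ _ ⟨χ, h, h'⟩; exact ⟨χ, h, χ.formsClosed_subforms.and_left h'⟩
  · rintro _ _ ⟨χ, h, h'⟩; exact ⟨χ, h, χ.formsClosed_subforms.and_right h'⟩
  · rintro _ ⟨χ, h, h'⟩; exact ⟨χ, h, χ.formsClosed_subforms.dia h'⟩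
  · rintro _ ⟨χ, h, h'⟩; exact ⟨χ, h, χ.formsClosed_subforms.diaPlus h'⟩

/-- The formulas of `Φ` that hold at a node. -/
def nodeType (Φ : Set (Form Sig)) (T : XMLTree Sig Gam D) (M : Set T.V) (v : T.V) : Set Φ :=
  {φ | φ.1.sat T M v}

/-- The formulas of `Φ` that hold at some child of a node. -/
def childType (Φ : Set (Form Sig)) (T : XMLTree Sig Gam D) (M : Set T.V) (v : T.V) : Set Φ :=
  {φ | ∃ w, T.E v w ∧ φ.1.sat T M w}

/-- Evaluation of a formula at a node with element name `l`, from the formulas that hold at its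
children; `m` tells whether the node is marked. -/
def Form.eval (Φ : Set (Form Sig)) (l : Sig) (m : Prop) (U : Set Φ) : Form Sig → Prop
  | .test .any => True
  | .test (.name l') => l = l'
  | .mark => m
  | .tt => True
  | .and φ ψ => φ.eval Φ l m U ∧ ψ.eval Φ l m U
  | .dia φ => φ ∈ Subtype.val '' U
  | .diaPlus φ => φ ∈ Subtype.val '' U ∨ .diaPlus φ ∈ Subtype.val '' U

def localType (Φ : Set (Form Sig)) (l : Sig) (m : Prop) (U : Set Φ) : Set Φ :=
  {φ | φ.1.eval Φ l m U}

/-- For `diaPlus`, a proper descendant is either a child or a proper descendant of a child. Both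
cases are visible in the child type, as `Φ` contains `φ` and `diaPlus φ`. -/
theorem Form.sat_iff_eval {Φ : Set (Form Sig)} (hΦ : FormsClosed Φ) {T : XMLTree Sig Gam D}
    (M : Set T.V) {v : T.V} {l : Sig} (hv : T.lab v = .elem l) :
    ∀ φ ∈ Φ, φ.sat T M v ↔ φ.eval Φ l (v ∈ M) (childType Φ T M v)
  | .test .any, _ => by simp [Form.sat, Form.eval, StepTest.sem, hv]
  | .test (.name l'), _ => by simp [Form.sat, Form.eval, StepTest.sem, hv]
  | .mark, _ => Iff.rfl
  | .tt, _ => Iff.rfl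
  | .and φ ψ, h => by
    simp only [Form.sat, Form.eval, Form.sat_iff_eval hΦ M hv φ (hΦ.and_left h),
      Form.sat_iff_eval hΦ M hv ψ (hΦ.and_right h)]
  | .dia φ, h => by
    simp [Form.sat, Form.eval, childType, hΦ.dia h]
  | .diaPlus φ, h => by
    simp only [Form.sat, Form.eval, childType, Set.mem_image, Set.mem_ofPred_eq, Subtype.exists,
      exists_and_right, exists_eq_right, hΦ.diaPlus h, h, exists_const]
    constructor
    · rintro ⟨w, hw, hφ⟩
      obtain ⟨x, hx, hx'⟩ := Relation.TransGen.head'_iff.1 hw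
      rcases hx'.cases_head with rfl | ⟨y, hy, hy'⟩
      · exact .inl ⟨x, hx, hφ⟩
      · exact .inr ⟨x, hx, w, .head' hy hy', hφ⟩
    · rintro (⟨w, hw, hφ⟩ | ⟨x, hx, w, hw, hφ⟩)
      · exact ⟨w, .single hw, hφ⟩
      · exact ⟨w, .head hx hw, hφ⟩

theorem nodeType_eq_localType {Φ : Set (Form Sig)} (hΦ : FormsClosed Φ) {T : XMLTree Sig Gam D}
    (M : Set T.V) {v : T.V} {l : Sig} (hv : T.lab v = .elem l) :
    nodeType Φ T M v = localType Φ l (v ∈ M) (childType Φ T M v) :=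
  Set.ext fun φ => φ.1.sat_iff_eval hΦ M hv φ.2

theorem Form.eval_congr_name {Φ : Set (Form Sig)} (hΦ : FormsClosed Φ) {l l' : Sig}
    (h : ∀ k, Form.test (.name k) ∈ Φ → (l = k ↔ l' = k)) (m : Prop) (U : Set Φ) :
    ∀ φ ∈ Φ, φ.eval Φ l m U ↔ φ.eval Φ l' m U
  | .test .any, _ => Iff.rfl
  | .test (.name k), hk => h k hk
  | .mark, _ => Iff.rfl
  | .tt, _ => Iff.rfl
  | .and φ ψ, hφ => by
    simp only [Form.eval, Form.eval_congr_name hΦ h m U φ (hΦ.and_left hφ),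
      Form.eval_congr_name hΦ h m U ψ (hΦ.and_right hφ)]
  | .dia _, _ => Iff.rfl
  | .diaPlus _, _ => Iff.rfl

theorem localType_congr_name {Φ : Set (Form Sig)} (hΦ : FormsClosed Φ) {l l' : Sig}
    (h : ∀ k, Form.test (.name k) ∈ Φ → (l = k ↔ l' = k)) (m : Prop) (U : Set Φ) :
    localType Φ l m U = localType Φ l' m U :=
  Set.ext fun φ => φ.1.eval_congr_name hΦ h m U φ.2

/-- The child types of roots that have, for each of the given formulas, a child satisfying it. -/
def reqTypes (Gam D : Type) (Φ : Set (Form Sig)) (gs : List (Form Sig)) : Set (Set Φ) :=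
  {U | ∃ T : XMLTree Sig Gam D, (∃ l, T.lab T.root = .elem l) ∧
    (∀ g ∈ gs, (Form.dia g).sat T ∅ T.root) ∧ U = childType Φ T ∅ T.root}

/-- The types of roots of trees without mark that satisfy a formula. -/
def formTypes (Gam D : Type) (Φ : Set (Form Sig)) (g : Form Sig) : Set (Set Φ) :=
  {τ | ∃ T : XMLTree Sig Gam D, g.sat T ∅ T.root ∧ τ = nodeType Φ T ∅ T.root}

/-- The types of roots of trees with one marked node that satisfy a formula. -/
def markedTypes (Gam D : Type) (Φ : Set (Form Sig)) (g : Form Sig) : Set (Set Φ) :=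
  {τ | ∃ (T : XMLTree Sig Gam D) (n : T.V), g.sat T {n} T.root ∧ τ = nodeType Φ T {n} T.root}

-- Types under subtrees, grafting and relabelling

theorem nodeType_subtree (Φ : Set (Form Sig)) (T : XMLTree Sig Gam D) (M : Set T.V) (v : T.V) :
    nodeType Φ (T.subtree v) {x | x.1 ∈ M} (T.subtree v).root = nodeType Φ T M v :=
  Set.ext fun φ => T.sat_subtree v M φ.1

theorem childType_graft (Φ : Set (Form Sig)) (T : XMLTree Sig Gam D)
    (hT : ∃ l, T.lab T.root = .elem l) (T' : XMLTree Sig Gam D) (M : Set (T.graft hT T').V) :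
    childType Φ (T.graft hT T') M (T.graft hT T').root =
      childType Φ T (T.graftInl hT T' ⁻¹' M) T.root ∪
        nodeType Φ T' (T.graftInr hT T' ⁻¹' M) T'.root := by
  ext φ
  simp only [childType, nodeType, Set.mem_union, Set.mem_ofPred_eq, T.graft_edge_root]
  constructor
  · rintro ⟨w, ⟨w', h, rfl⟩ | rfl, hφ⟩
    · exact .inl ⟨w', h, (T.sat_graftInl hT T' M (T.ne_root_of_edge h) φ.1).1 hφ⟩
    · exact .inr ((T.sat_graftInr hT T' M _ φ.1).1 hφ)
  · rintro (⟨w, h, hφ⟩ | hφ)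
    · exact ⟨_, .inl ⟨w, h, rfl⟩, (T.sat_graftInl hT T' M (T.ne_root_of_edge h) φ.1).2 hφ⟩
    · exact ⟨_, .inr rfl, (T.sat_graftInr hT T' M _ φ.1).2 hφ⟩

theorem XMLTree.sat_dia_graft (T : XMLTree Sig Gam D)
    (hT : ∃ l, T.lab T.root = .elem l) (T' : XMLTree Sig Gam D) (M : Set (T.graft hT T').V)
    (g : Form Sig) :
    (Form.dia g).sat (T.graft hT T') M (T.graft hT T').root ↔
      (Form.dia g).sat T (T.graftInl hT T' ⁻¹' M) T.root ∨
        g.sat T' (T.graftInr hT T' ⁻¹' M) T'.root := by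
  simp only [Form.sat, T.graft_edge_root]
  constructor
  · rintro ⟨w, ⟨w', h, rfl⟩ | rfl, hφ⟩
    · exact .inl ⟨w', h, (T.sat_graftInl hT T' M (T.ne_root_of_edge h) g).1 hφ⟩
    · exact .inr ((T.sat_graftInr hT T' M _ g).1 hφ)
  · rintro (⟨w, h, hφ⟩ | hφ)
    · exact ⟨_, .inl ⟨w, h, rfl⟩, (T.sat_graftInl hT T' M (T.ne_root_of_edge h) g).2 hφ⟩
    · exact ⟨_, .inr rfl, (T.sat_graftInr hT T' M _ g).2 hφ⟩

/-- Requirements can be added one at a time: grafting a witness for `g` below a root adds exactly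
the type of the witness and keeps the earlier requirements satisfied. -/
theorem reqTypes_cons (Φ : Set (Form Sig)) (g : Form Sig) (gs : List (Form Sig)) :
    reqTypes Gam D Φ (g :: gs) =
      Set.image2 (· ∪ ·) (reqTypes Gam D Φ gs) (formTypes Gam D Φ g) := by
  ext U
  constructor
  · rintro ⟨T, hl, h, rfl⟩
    obtain ⟨c, hc, hg⟩ := h g (by simp)
    refine ⟨_, ⟨T, hl, fun g' hg' => h g' (by simp [hg']), rfl⟩, nodeType Φ T ∅ c,
      ⟨T.subtree c, (T.sat_subtree c ∅ g).2 hg, (nodeType_subtree Φ T ∅ c).symm⟩, ?_⟩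
    -- `T` is its own witness for `gs`: the type of its child `c` is already part of its child type.
    exact Set.union_eq_left.2 fun φ hφ => ⟨c, hc, hφ⟩
  · rintro ⟨_, ⟨T, hl, h, rfl⟩, _, ⟨T', hg, rfl⟩, rfl⟩
    refine ⟨T.graft hl T', hl, fun g' hg' => ?_, ?_⟩
    · rw [T.sat_dia_graft]
      rcases List.mem_cons.1 hg' with rfl | hg'
      · exact .inr hg
      · exact .inl (h g' hg')
    · rw [childType_graft]
      rfl

theorem childType_relabel (Φ : Set (Form Sig)) (T : XMLTree Sig Gam D) (l : Sig) {M M' : Set T.V}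
    (h : ∀ v, v ≠ T.root → (v ∈ M ↔ v ∈ M')) :
    childType Φ (T.relabel l) M T.root = childType Φ T M' T.root :=
  Set.ext fun φ => exists_congr fun _ =>
    and_congr_right fun e => T.sat_relabel l h (T.ne_root_of_edge e) φ.1

theorem XMLTree.sat_dia_relabel (T : XMLTree Sig Gam D) (l : Sig) {M M' : Set T.V}
    (h : ∀ v, v ≠ T.root → (v ∈ M ↔ v ∈ M')) (g : Form Sig) :
    (Form.dia g).sat (T.relabel l) M T.root ↔ (Form.dia g).sat T M' T.root :=
  exists_congr fun _ => and_congr_right fun e => T.sat_relabel l h (T.ne_root_of_edge e) g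

/-! ### Pattern nodes -/

/-- A node of a tree pattern: an optional element name, and formulas to be satisfied by children. -/
structure Frame (Sig : Type) : Type where
  name : Option Sig
  reqs : List (Form Sig)

/-- `l` is a possible element name of the pattern node. -/
def Frame.Allows (f : Frame Sig) (l : Sig) : Prop :=
  ∀ k ∈ f.name, l = k

def Frame.test (f : Frame Sig) : StepTest Sig :=
  match f.name with
  | none => .any
  | some l => .name l

def diaForms : List (Form Sig) → Form Sig
  | [] => .tt
  | g :: gs => .and (.dia g) (diaForms gs)

/-- The pattern node, together with the formula `φ`. -/
def Frame.form (f : Frame Sig) (φ : Form Sig) : Form Sig :=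
  .and (.test f.test) (.and (diaForms f.reqs) φ)

theorem Form.sat_diaForms (T : XMLTree Sig Gam D) (M : Set T.V) (v : T.V) (gs : List (Form Sig)) :
    (diaForms gs).sat T M v ↔ ∀ g ∈ gs, (Form.dia g).sat T M v := by
  induction gs with
  | nil => simp [diaForms, Form.sat]
  | cons g gs ih => simp [diaForms, Form.sat, ih]

theorem Frame.sat_test (f : Frame Sig) (T : XMLTree Sig Gam D) (M : Set T.V) (v : T.V) :
    (Form.test f.test).sat T M v ↔ ∃ l, T.lab v = .elem l ∧ f.Allows l := by
  obtain ⟨_ | k, gs⟩ := f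
  · simp [Form.sat, Frame.test, StepTest.sem, Frame.Allows, eq_comm]
  · simp [Form.sat, Frame.test, StepTest.sem, Frame.Allows]

theorem Frame.sat_form (f : Frame Sig) (φ : Form Sig) (T : XMLTree Sig Gam D) (M : Set T.V)
    (v : T.V) : (f.form φ).sat T M v ↔ (∃ l, T.lab v = .elem l ∧ f.Allows l) ∧
      (∀ g ∈ f.reqs, (Form.dia g).sat T M v) ∧ φ.sat T M v := by
  rw [← f.sat_test T M v, ← Form.sat_diaForms]
  rfl

/-- The child type does not depend on the name of the root, so every child type combines with every
allowed name. -/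
theorem formTypes_frame {Φ : Set (Form Sig)} (hΦ : FormsClosed Φ) (f : Frame Sig) :
    formTypes Gam D Φ (f.form .tt) =
      {τ | ∃ U ∈ reqTypes Gam D Φ f.reqs, ∃ l, f.Allows l ∧ τ = localType Φ l False U} := by
  ext τ
  constructor
  · rintro ⟨T, h, rfl⟩
    obtain ⟨⟨l, hl, hf⟩, hg, -⟩ := (f.sat_form _ _ _ _).1 h
    exact ⟨_, ⟨T, ⟨l, hl⟩, hg, rfl⟩, l, hf, nodeType_eq_localType hΦ ∅ hl⟩
  · rintro ⟨_, ⟨T, -, hg, rfl⟩, l, hf, rfl⟩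
    have hM : ∀ v, v ≠ T.root → (v ∈ (∅ : Set T.V) ↔ v ∈ (∅ : Set T.V)) := fun _ _ => Iff.rfl
    refine ⟨T.relabel l, (f.sat_form _ _ _ _).2 ⟨⟨l, T.lab_relabel l, hf⟩,
      fun g h => (T.sat_dia_relabel l hM g).2 (hg g h), trivial⟩, ?_⟩
    refine .symm ((nodeType_eq_localType hΦ ∅ (T.lab_relabel l)).trans ?_)
    exact congrArg _ (childType_relabel Φ T l hM)

theorem markedTypes_frame_mark {Φ : Set (Form Sig)} (hΦ : FormsClosed Φ) (f : Frame Sig) :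
    markedTypes Gam D Φ (f.form .mark) =
      {τ | ∃ U ∈ reqTypes Gam D Φ f.reqs, ∃ l, f.Allows l ∧ τ = localType Φ l True U} := by
  ext τ
  constructor
  · rintro ⟨T, n, h, rfl⟩
    obtain ⟨⟨l, hl, hf⟩, hg, hn⟩ := (f.sat_form _ _ _ _).1 h
    obtain rfl : T.root = n := hn
    -- The only marked node is the root, which lies below none of its children.
    have key : ∀ (φ : Form Sig) (w : T.V), T.E T.root w →
        (φ.sat T {T.root} w ↔ φ.sat T ∅ w) := fun φ w hw =>
      Form.sat_iff_of_marks (fun x hx => by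
        simp only [Set.mem_singleton_iff, Set.mem_empty_iff_false, iff_false]
        rintro rfl
        exact T.not_transGen_root _ (Relation.TransGen.head' hw hx)) φ
    refine ⟨_, ⟨T, ⟨l, hl⟩, fun g h => ?_, rfl⟩, l, hf, ?_⟩
    · obtain ⟨w, hw, hs⟩ := hg g h
      exact ⟨w, hw, (key g w hw).1 hs⟩
    · rw [nodeType_eq_localType hΦ _ hl]
      congr 1
      · simp
      · exact Set.ext fun φ => exists_congr fun w => and_congr_right fun hw => key φ.1 w hw
  · rintro ⟨_, ⟨T, -, hg, rfl⟩, l, hf, rfl⟩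
    have hM : ∀ v, v ≠ T.root → (v ∈ ({T.root} : Set T.V) ↔ v ∈ (∅ : Set T.V)) :=
      fun v hv => by simp [hv]
    refine ⟨T.relabel l, T.root, (f.sat_form _ _ _ _).2 ⟨⟨l, T.lab_relabel l, hf⟩,
      fun g h => (T.sat_dia_relabel l hM g).2 (hg g h), rfl⟩, ?_⟩
    refine .symm ((nodeType_eq_localType hΦ _ (T.lab_relabel l)).trans ?_)
    congr 1
    · exact eq_true (show T.root ∈ ({T.root} : Set T.V) from rfl)
    · exact childType_relabel Φ T l hM

/-- The mark lies below exactly one child, the one that satisfies `g`. The rest of the tree can be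
evaluated without mark, which is sound for the requirements because they do not mention it. -/
theorem markedTypes_frame_dia {Φ : Set (Form Sig)} (hΦ : FormsClosed Φ) (f : Frame Sig)
    (hf : ∀ g ∈ f.reqs, g.MarkFree) {g : Form Sig} (hg : g.Marked) :
    markedTypes Gam D Φ (f.form (.dia g)) =
      {τ | ∃ U ∈ reqTypes Gam D Φ f.reqs, ∃ τ' ∈ markedTypes Gam D Φ g, ∃ l, f.Allows l ∧
        τ = localType Φ l False (U ∪ τ')} := by
  ext τ
  constructor
  · rintro ⟨T, n, h, rfl⟩
    obtain ⟨⟨l, hl, hfl⟩, hr, c, hc, hs⟩ := (f.sat_form _ _ _ _).1 h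
    obtain ⟨_, rfl, hn⟩ := hg.exists_mem T _ c hs
    rename_i n
    refine ⟨childType Φ T ∅ T.root, ⟨T, ⟨l, hl⟩, fun g' hg' => ?_, rfl⟩,
      nodeType Φ T {n} c, ⟨T.subtree c, ⟨n, hn⟩, ?_, ?_⟩, l, hfl, ?_⟩
    · exact (Form.MarkFree.sat_iff T _ _ (φ := .dia g') (hf g' hg') _).1 (hr g' hg')
    · rw [← T.sat_subtree] at hs
      convert hs using 1
      ext x
      exact Subtype.ext_iff
    · rw [← nodeType_subtree]
      congr 1
      ext x
      exact (Subtype.ext_iff (a1 := x) (a2 := ⟨n, hn⟩)).symm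
    · rw [nodeType_eq_localType hΦ _ hl]
      congr 1
      · simp only [Set.mem_singleton_iff, eq_iff_iff, iff_false]
        rintro rfl
        exact T.not_transGen_root _ (Relation.TransGen.head' hc hn)
      · ext φ
        constructor
        · rintro ⟨w, hw, hφ⟩
          by_cases hwn : Relation.ReflTransGen T.E w n
          · obtain rfl := T.child_unique hc hw hn hwn
            exact .inr hφ
          · refine .inl ⟨w, hw, (Form.sat_iff_of_marks (fun x hx => ?_) φ.1).1 hφ⟩
            simp only [Set.mem_singleton_iff, Set.mem_empty_iff_false, iff_false]
            rintro rfl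
            exact hwn hx
        · rintro (⟨w, hw, hφ⟩ | hφ)
          -- Positivity: removing the mark also from below `c` adds nothing to the child type beyond
          -- the marked type of `c`.
          · exact ⟨w, hw, φ.1.sat_mono T (Set.empty_subset _) w hφ⟩
          · exact ⟨c, hc, hφ⟩
  · rintro ⟨_, ⟨T, -, hr, rfl⟩, _, ⟨T', n, hs, rfl⟩, l, hfl, rfl⟩
    -- Conversely, rename the root of `T` to `l` and graft the marked tree `T'` below it.
    have hM : ∀ v, v ≠ T.root → (v ∈ (∅ : Set T.V) ↔ v ∈ (∅ : Set T.V)) := fun _ _ => Iff.rfl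
    have hl : ∃ l', (T.relabel l).lab (T.relabel l).root = .elem l' := ⟨l, T.lab_relabel l⟩
    have h1 : (T.relabel l).graftInl hl T' ⁻¹' {(T.relabel l).graftInr hl T' n} = ∅ :=
      Set.eq_empty_of_forall_notMem fun x hx => Sum.inl_ne_inr hx
    have h2 : (T.relabel l).graftInr hl T' ⁻¹' {(T.relabel l).graftInr hl T' n} = {n} :=
      Set.ext fun x => Sum.inr_injective.eq_iff
    refine ⟨(T.relabel l).graft hl T', (T.relabel l).graftInr hl T' n,
      (f.sat_form _ _ _ _).2 ⟨⟨l, T.lab_relabel l, hfl⟩, fun g' hg' => ?_, ?_⟩, ?_⟩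
    · rw [XMLTree.sat_dia_graft, h1]
      exact .inl ((T.sat_dia_relabel l hM g').2 (hr g' hg'))
    · rw [XMLTree.sat_dia_graft, h2]
      exact .inr hs
    · refine .symm ((nodeType_eq_localType hΦ _ (T := (T.relabel l).graft hl T')
        (v := ((T.relabel l).graft hl T').root) (T.lab_relabel l)).trans ?_)
      rw [childType_graft, h1, h2]
      congr 1
      · exact eq_false fun h => Sum.inl_ne_inr h
      · exact congrArg (· ∪ _) (childType_relabel Φ T l hM)

end

section

variable {Sig Gam D : Type}

/-! ### From paths without descendant steps to tree patterns -/

/-- The tree pattern with an open branch of pattern nodes, the last of which satisfies `χ`. -/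
def branchForm : List (Frame Sig) → Form Sig → Form Sig
  | [], χ => χ
  | g :: gs, χ => branchForm gs (g.form (.dia χ))

theorem sat_branchForm_congr {T : XMLTree Sig Gam D} {M : Set T.V} :
    ∀ (fs : List (Frame Sig)) {χ χ' : Form Sig}, (∀ v, χ.sat T M v ↔ χ'.sat T M v) →
      ∀ v, (branchForm fs χ).sat T M v ↔ (branchForm fs χ').sat T M v
  | [], _, _, h, v => h v
  | g :: gs, χ, χ', h, v => by
    refine sat_branchForm_congr gs (fun w => ?_) v
    simp only [Frame.sat_form, Form.sat, h]

theorem not_sat_branchForm {T : XMLTree Sig Gam D} {M : Set T.V} :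
    ∀ (fs : List (Frame Sig)) {χ : Form Sig}, (∀ v, ¬ χ.sat T M v) →
      ∀ v, ¬ (branchForm fs χ).sat T M v
  | [], _, h, v => h v
  | g :: gs, χ, h, v => by
    refine not_sat_branchForm gs (fun w hw => ?_) v
    obtain ⟨-, -, x, -, hx⟩ := (g.sat_form _ _ _ _).1 hw
    exact h x hx

/-- Here `none` stands for falsity: a contradiction at the last node makes the whole branch
unsatisfiable. -/
theorem sat_branchForm_iff_exists {T : XMLTree Sig Gam D} {M : Set T.V} {α : Type}
    (fs : List (Frame Sig)) {χ : Form Sig} (o : Option α) (ψ : α → Form Sig)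
    (h : ∀ v, χ.sat T M v ↔ ∃ x ∈ o, (ψ x).sat T M v) (v : T.V) :
    (branchForm fs χ).sat T M v ↔ ∃ x ∈ o, (branchForm fs (ψ x)).sat T M v := by
  cases o with
  | none => simpa using not_sat_branchForm fs (by simpa using h) v
  | some x => simpa using sat_branchForm_congr fs (by simpa using h) v

open Classical in
/-- The pattern node with an additional step test, unless that is unsatisfiable. -/
noncomputable def Frame.restrict (f : Frame Sig) : StepTest Sig → Option (Frame Sig)
  | .any => some f
  | .name l =>
    match f.name with
    | none => some ⟨some l, f.reqs⟩
    | some l' => if l = l' then some f else none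

theorem Frame.sat_form_and_test (f : Frame Sig) (t : StepTest Sig) (φ : Form Sig)
    (T : XMLTree Sig Gam D) (M : Set T.V) (v : T.V) :
    (f.form (.and (.test t) φ)).sat T M v ↔ ∃ f' ∈ f.restrict t, (f'.form φ).sat T M v := by
  obtain ⟨k, gs⟩ := f
  rcases t with l | _
  · rcases k with _ | k
    · simp only [Frame.restrict, Option.mem_some_iff, exists_eq_left', Frame.sat_form, Form.sat,
        StepTest.sem, Frame.Allows]
      simp only [Set.mem_singleton_iff, forall_eq', Option.not_mem_none,
        IsEmpty.forall_iff, implies_true, and_true, exists_eq_right]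
      constructor
      · rintro ⟨-, h, h', h''⟩
        exact ⟨h', h, h''⟩
      · rintro ⟨h', h, h''⟩
        exact ⟨⟨l, h'⟩, h, h', h''⟩
    · by_cases hk : l = k
      · subst hk
        simp only [Frame.restrict, if_true, Option.mem_some_iff, exists_eq_left', Frame.sat_form,
          Form.sat, StepTest.sem, Frame.Allows, Set.mem_singleton_iff, forall_eq', exists_eq_right]
        tauto
      · simp only [Frame.restrict, if_neg hk, Frame.sat_form, Form.sat, StepTest.sem, Frame.Allows,
          Set.mem_singleton_iff, Option.mem_some_iff, forall_eq', exists_eq_right,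
          Option.not_mem_none, false_and, exists_false, iff_false]
        rintro ⟨h, -, h', -⟩
        rw [h] at h'
        exact hk (Label.elem.inj h').symm
  · simp only [Frame.restrict, Option.mem_some_iff, exists_eq_left', Frame.sat_form, Form.sat,
      StepTest.sem, Set.mem_range]
    constructor
    · rintro ⟨h, h', -, h''⟩
      exact ⟨h, h', h''⟩
    · rintro ⟨⟨l, hl, h⟩, h', h''⟩
      exact ⟨⟨l, hl, h⟩, h', ⟨l, hl.symm⟩, h''⟩

theorem Frame.sat_form_iff_tt (f : Frame Sig) (φ : Form Sig) (T : XMLTree Sig Gam D) (M : Set T.V)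
    (v : T.V) : (f.form φ).sat T M v ↔ (f.form .tt).sat T M v ∧ φ.sat T M v := by
  simp only [Frame.sat_form, Form.sat, and_true, and_assoc]

/-- Turns an open branch into requirements of its first node. -/
def collapse : Frame Sig → List (Frame Sig) → Frame Sig
  | f, [] => f
  | f, g :: gs => collapse ⟨g.name, f.form .tt :: g.reqs⟩ gs

/-- Once nothing more is to be said about the last node of a branch, that node is just one more
requirement on its parent; repeat up to the first node. -/
theorem sat_collapse {T : XMLTree Sig Gam D} {M : Set T.V} (fs : List (Frame Sig)) :
    ∀ (f : Frame Sig) (v : T.V), ((collapse f fs).form .tt).sat T M v ↔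
      (branchForm fs (f.form .tt)).sat T M v := by
  induction fs with
  | nil => exact fun _ _ => Iff.rfl
  | cons g gs ih =>
    intro f v
    refine (ih _ v).trans (sat_branchForm_congr gs (fun w => ?_) v)
    rw [Frame.sat_form, Frame.sat_form]
    simp only [List.mem_cons, forall_eq_or_imp, Frame.Allows, Form.sat]
    tauto

mutual
/-- Adds a path to a tree pattern, at the last node of the open branch `f :: fs`. The result is
`none` if two different names are required of the same node. -/
noncomputable def Path.exec :
    Path Sig → Frame Sig → List (Frame Sig) → Option (Frame Sig × List (Frame Sig))
  | .step .self t, f, fs => (f.restrict t).map (·, fs)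
  | .step .child t, f, fs => ((⟨none, []⟩ : Frame Sig).restrict t).map (·, f :: fs)
  | .step .descendant _, _, _ => none
  | .comp p p', f, fs => (p.exec f fs).bind fun x => p'.exec x.1 x.2
  | .filter p q, f, fs => (p.exec f fs).bind fun x => q.exec x.1 x.2

noncomputable def Filter.exec :
    Filter Sig → Frame Sig → List (Frame Sig) → Option (Frame Sig × List (Frame Sig))
  | .path p, f, fs => (p.exec f []).map fun x => (collapse x.1 x.2, fs)
  | .conj q q', f, fs => (q.exec f fs).bind fun x => q'.exec x.1 x.2
  | .tt, f, fs => some (f, fs)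
end

theorem exists_mem_bind {α β : Type} (o : Option α) (g : α → Option β) (r : β → Prop) :
    (∃ y ∈ o.bind g, r y) ↔ ∃ x ∈ o, ∃ y ∈ g x, r y := by
  cases o <;> simp

theorem exists_mem_map {α β : Type} (o : Option α) (g : α → β) (r : β → Prop) :
    (∃ y ∈ o.map g, r y) ↔ ∃ x ∈ o, r (g x) := by
  cases o <;> simp

mutual
-- Invariant of a left-to-right reading of the path: `f` is the current node, `fs` its ancestors
-- with the nearest first, and `φ` what remains to be said at the node reached.
theorem Path.sat_exec (T : XMLTree Sig Gam D) (M : Set T.V) :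
    ∀ (p : Path Sig), p.DescendantFree → ∀ (f : Frame Sig) (fs : List (Frame Sig)) (φ : Form Sig)
      (v : T.V), (branchForm fs (f.form (p.form φ))).sat T M v ↔
        ∃ x ∈ p.exec f fs, (branchForm x.2 (x.1.form φ)).sat T M v
  | .step .self t, _, f, fs, φ, v => by
    rw [Path.exec, exists_mem_map]
    exact sat_branchForm_iff_exists fs _ _ (fun w => f.sat_form_and_test t φ T M w) v
  | .step .child t, _, f, fs, φ, v => by
    rw [Path.exec, exists_mem_map]
    refine Iff.trans ?_ (sat_branchForm_iff_exists (f :: fs) _ _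
      (fun w => (⟨none, []⟩ : Frame Sig).sat_form_and_test t φ T M w) v)
    refine sat_branchForm_congr (f :: fs) (fun w => ?_) v
    rw [Frame.sat_form]
    simp only [Form.sat, List.not_mem_nil, IsEmpty.forall_iff, implies_true, true_and,
      Frame.Allows, Option.not_mem_none, and_true]
    refine (and_iff_right_of_imp fun h => ?_).symm
    rcases t with l | _
    · exact ⟨l, h.1⟩
    · exact h.1.imp fun _ h => h.symm
  | .comp p p', h, f, fs, φ, v => by
    rw [Path.exec, exists_mem_bind, Path.form, Path.sat_exec T M p h.1]
    simp only [Path.sat_exec T M p' h.2]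
  | .filter p q, h, f, fs, φ, v => by
    rw [Path.exec, exists_mem_bind, Path.form, Path.sat_exec T M p h.1]
    simp only [Filter.sat_exec T M q h.2]

theorem Filter.sat_exec (T : XMLTree Sig Gam D) (M : Set T.V) :
    ∀ (q : Filter Sig), q.DescendantFree → ∀ (f : Frame Sig) (fs : List (Frame Sig))
      (φ : Form Sig) (v : T.V), (branchForm fs (f.form (.and q.form φ))).sat T M v ↔
        ∃ x ∈ q.exec f fs, (branchForm x.2 (x.1.form φ)).sat T M v
  | .path p, h, f, fs, φ, v => by
    rw [Filter.exec, exists_mem_map]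
    refine sat_branchForm_iff_exists fs _ _ (fun w => ?_) v
    -- The filter starts at `f` itself with an empty branch, because `self` steps in a filter may
    -- constrain the name of `f`.
    have key := Path.sat_exec T M p h f [] .tt w
    simp only [branchForm] at key
    rw [Filter.form, Frame.sat_form_iff_tt]
    simp only [Form.sat]
    rw [← and_assoc, ← Frame.sat_form_iff_tt, key, ← exists_and_right]
    refine exists_congr fun x => ?_
    rw [Frame.sat_form_iff_tt (collapse x.1 x.2), sat_collapse, and_assoc]
  | .conj q q', h, f, fs, φ, v => by
    rw [Filter.exec, exists_mem_bind]
    have e : (branchForm fs (f.form (.and (Filter.conj q q').form φ))).sat T M v ↔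
        (branchForm fs (f.form (.and q.form (.and q'.form φ)))).sat T M v :=
      sat_branchForm_congr fs (fun w => by
        simp only [Frame.sat_form, Filter.form, Form.sat, and_assoc]) v
    rw [e, Filter.sat_exec T M q h.1]
    simp only [Filter.sat_exec T M q' h.2]
  | .tt, h, f, fs, φ, v => by
    simp only [Filter.exec, Option.mem_some_iff, exists_eq_left']
    exact sat_branchForm_congr fs (fun w => by
      simp only [Frame.sat_form, Filter.form, Form.sat, true_and]) v
end

/-- A `self` step tests its starting node, and for the other axes that node has a child. This is why
the initial pattern node, which admits only elements, loses nothing. -/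
theorem Path.elem_of_rel (T : XMLTree Sig Gam D) :
    ∀ (p : Path Sig) {v w : T.V}, p.rel T v w → ∃ l, T.lab v = .elem l
  | .step .self t, v, w, h => by
    obtain ⟨rfl, h⟩ := h
    rcases t with l | _
    · exact ⟨l, h⟩
    · exact h.imp fun _ h => h.symm
  | .step .child t, v, w, h => T.elem_of_edge h.1
  | .step .descendant t, v, w, h => by
    obtain ⟨x, hx, -⟩ := Relation.TransGen.head'_iff.1 h.1
    exact T.elem_of_edge hx
  | .comp p p', v, w, h => by
    obtain ⟨x, hx, -⟩ := h
    exact Path.elem_of_rel T p hx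
  | .filter p q, v, w, h => Path.elem_of_rel T p h.1

theorem Path.sat_form_iff_exec (T : XMLTree Sig Gam D) (M : Set T.V) (p : Path Sig)
    (hp : p.DescendantFree) (φ : Form Sig) (v : T.V) :
    (p.form φ).sat T M v ↔
      ∃ x ∈ p.exec ⟨none, []⟩ [], (branchForm x.2 (x.1.form φ)).sat T M v := by
  rw [← Path.sat_exec T M p hp]
  simp only [branchForm, Frame.sat_form, List.not_mem_nil, IsEmpty.forall_iff, implies_true,
    true_and, Frame.Allows, Option.not_mem_none, and_true]
  refine (and_iff_right_of_imp fun h => ?_).symm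
  obtain ⟨w, hw, -⟩ := (Path.sat_form T M p φ v).1 h
  exact p.elem_of_rel T hw

theorem markedTypes_path (Φ : Set (Form Sig)) (p : Path Sig) (hp : p.DescendantFree) :
    markedTypes Gam D Φ (p.form .mark) =
      {τ | ∃ x ∈ p.exec ⟨none, []⟩ [], τ ∈ markedTypes Gam D Φ (branchForm x.2 (x.1.form .mark))} := by
  ext τ
  constructor
  · rintro ⟨T, n, h, rfl⟩
    obtain ⟨x, hx, h⟩ := (p.sat_form_iff_exec T _ hp _ _).1 h
    exact ⟨x, hx, T, n, h, rfl⟩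
  · rintro ⟨x, hx, T, n, h, rfl⟩
    exact ⟨T, n, (p.sat_form_iff_exec T _ hp _ _).2 ⟨x, hx, h⟩, rfl⟩

/-! ### Marks in tree patterns -/

def Frame.MarkFree (f : Frame Sig) : Prop :=
  ∀ g ∈ f.reqs, g.MarkFree

theorem Frame.MarkFree.form {f : Frame Sig} (hf : f.MarkFree) {φ : Form Sig} (hφ : φ.MarkFree) :
    (f.form φ).MarkFree := by
  refine ⟨trivial, ?_, hφ⟩
  have : ∀ gs : List (Form Sig), (∀ g ∈ gs, g.MarkFree) → (diaForms gs).MarkFree := by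
    intro gs h
    induction gs with
    | nil => trivial
    | cons g gs ih => exact ⟨h g (by simp), ih fun g' hg' => h g' (by simp [hg'])⟩
  exact this _ hf

theorem Frame.MarkFree.restrict {f f' : Frame Sig} (hf : f.MarkFree) {t : StepTest Sig}
    (h : f' ∈ f.restrict t) : f'.MarkFree := by
  obtain ⟨k, gs⟩ := f
  rcases t with l | _
  · rcases k with _ | k
    · simp only [Frame.restrict, Option.mem_some_iff] at h
      exact h ▸ hf
    · by_cases hk : l = k <;> simp [Frame.restrict, hk] at h
      exact h ▸ hf
  · simp only [Frame.restrict, Option.mem_some_iff] at h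
    exact h ▸ hf

theorem Frame.MarkFree.collapse {f : Frame Sig} {fs : List (Frame Sig)} (hf : f.MarkFree)
    (hfs : ∀ g ∈ fs, g.MarkFree) : (collapse f fs).MarkFree := by
  induction fs generalizing f with
  | nil => exact hf
  | cons g gs ih =>
    refine ih (fun x hx => ?_) fun x hx => hfs x (by simp [hx])
    rcases List.mem_cons.1 hx with rfl | hx
    · exact hf.form trivial
    · exact hfs g (by simp) x hx

mutual
-- Needed for `markedTypes_frame_dia`, where requirements are evaluated in trees without mark.
theorem Path.markFree_exec : ∀ (p : Path Sig) {f : Frame Sig} {fs : List (Frame Sig)}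
    {x : Frame Sig × List (Frame Sig)}, x ∈ p.exec f fs → (∀ g ∈ f :: fs, g.MarkFree) →
      ∀ g ∈ x.1 :: x.2, g.MarkFree
  | .step .self t, f, fs, x, hx, h => by
    obtain ⟨f', hf', rfl⟩ := Option.map_eq_some_iff.1 hx
    rw [List.forall_mem_cons] at h ⊢
    exact ⟨h.1.restrict hf', h.2⟩
  | .step .child t, f, fs, x, hx, h => by
    obtain ⟨f', hf', rfl⟩ := Option.map_eq_some_iff.1 hx
    rw [List.forall_mem_cons]
    exact ⟨Frame.MarkFree.restrict (f := ⟨none, []⟩) (by simp [Frame.MarkFree]) hf', h⟩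
  | .comp p p', f, fs, x, hx, h => by
    obtain ⟨y, hy, hx⟩ := Option.bind_eq_some_iff.1 hx
    exact p'.markFree_exec hx (p.markFree_exec hy h)
  | .filter p q, f, fs, x, hx, h => by
    obtain ⟨y, hy, hx⟩ := Option.bind_eq_some_iff.1 hx
    exact q.markFree_exec hx (p.markFree_exec hy h)

theorem Filter.markFree_exec : ∀ (q : Filter Sig) {f : Frame Sig} {fs : List (Frame Sig)}
    {x : Frame Sig × List (Frame Sig)}, x ∈ q.exec f fs → (∀ g ∈ f :: fs, g.MarkFree) →
      ∀ g ∈ x.1 :: x.2, g.MarkFree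
  | .path p, f, fs, x, hx, h => by
    obtain ⟨y, hy, rfl⟩ := Option.map_eq_some_iff.1 hx
    rw [List.forall_mem_cons] at h ⊢
    have hy' := List.forall_mem_cons.1 (p.markFree_exec hy (by simpa using h.1))
    exact ⟨hy'.1.collapse hy'.2, h.2⟩
  | .conj q q', f, fs, x, hx, h => by
    obtain ⟨y, hy, hx⟩ := Option.bind_eq_some_iff.1 hx
    exact q'.markFree_exec hx (q.markFree_exec hy h)
  | .tt, f, fs, x, hx, h => by
    obtain rfl := Option.some.inj hx
    exact h
end

theorem Form.Marked.frame {φ : Form Sig} (h : φ.Marked) (f : Frame Sig) : (f.form φ).Marked :=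
  .inr (.inr h)

/-! ### Computing types up to classes of names -/

/-- The types of the nodes whose element name is in class `k`, if that is given, and whose child
type is in `X`; `m` tells whether the nodes are marked. -/
def closeTypes {C : Type} (Φ : Set (Form Sig)) (cls : Sig → C) (m : Prop) (k : Option C)
    (X : Set (Set Φ)) : Set (Set Φ) :=
  {τ | ∃ U ∈ X, ∃ l, (∀ c ∈ k, cls l = c) ∧ τ = localType Φ l m U}

/-- The classes of names separate the names in `K` from each other and from all other names. -/
def Separates {α C : Type} (cls : α → C) (K : Set α) : Prop :=
  ∀ l l', cls l = cls l' → ∀ k ∈ K, (l = k ↔ l' = k)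

/-- The element names that occur in a set of formulas. -/
def formNames (Φ : Set (Form Sig)) : Set Sig :=
  {k | Form.test (.name k) ∈ Φ}

/-- Formulas of `Φ` compare names only with `formNames Φ`, so a name can be exchanged for any other
of its class. -/
theorem closeTypes_frame {C : Type} {Φ : Set (Form Sig)} (hΦ : FormsClosed Φ) {cls : Sig → C}
    (hcls : Separates cls (formNames Φ)) (m : Prop) (f : Frame Sig) (X : Set (Set Φ)) :
    closeTypes Φ cls m (f.name.map cls) X =
      {τ | ∃ U ∈ X, ∃ l, f.Allows l ∧ τ = localType Φ l m U} := by
  obtain ⟨_ | k, gs⟩ := f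
  · simp [closeTypes, Frame.Allows]
  · ext τ
    simp only [closeTypes, Frame.Allows, Option.map_some, Option.mem_some_iff, forall_eq']
    refine exists_congr fun U => and_congr_right fun _ => ?_
    constructor
    · rintro ⟨l, hl, rfl⟩
      exact ⟨k, rfl, localType_congr_name hΦ (fun k' hk' => hcls l k hl k' hk') m U⟩
    · rintro ⟨l, rfl, rfl⟩
      exact ⟨l, rfl, rfl⟩

/-- The marked types of an open branch, from those of its last node. -/
def branchTypes {C : Type} (Gam D : Type) (Φ : Set (Form Sig)) (cls : Sig → C) :
    Set (Set Φ) → List (Frame Sig) → Set (Set Φ)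
  | R, [] => R
  | R, g :: gs => branchTypes Gam D Φ cls
      (closeTypes Φ cls False (g.name.map cls) (Set.image2 (· ∪ ·) (reqTypes Gam D Φ g.reqs) R)) gs

/-- Each step outwards along the branch is one application of `markedTypes_frame_dia`. -/
theorem markedTypes_branchForm {C : Type} {Φ : Set (Form Sig)} (hΦ : FormsClosed Φ)
    {cls : Sig → C} (hcls : Separates cls (formNames Φ)) (fs : List (Frame Sig))
    (hfs : ∀ g ∈ fs, g.MarkFree) {χ : Form Sig} (hχ : χ.Marked) :
    markedTypes Gam D Φ (branchForm fs χ) =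
      branchTypes Gam D Φ cls (markedTypes Gam D Φ χ) fs := by
  induction fs generalizing χ with
  | nil => rfl
  | cons g gs ih =>
    rw [branchForm, ih (fun g' h => hfs g' (by simp [h])) (Form.Marked.frame (φ := .dia χ) hχ g),
      branchTypes, markedTypes_frame_dia hΦ g (hfs g (by simp)) hχ, closeTypes_frame hΦ hcls]
    congr 1
    ext τ
    simp only [Set.mem_ofPred_eq, Set.exists_mem_image2]

/-! ### Policies -/

/-- What an atomic update does to its node, up to the choice of a tree with given root label. -/
inductive Action (Sig Gam D : Type) : Type
  | insert (a : Label Sig Gam D)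
  | update (a : Label Sig Gam D)
  | delete

def AtomicUpdate.node {T : XMLTree Sig Gam D} : AtomicUpdate T → T.V
  | .insert n _ => n
  | .update n _ => n
  | .delete n => n

def AtomicUpdate.action {T : XMLTree Sig Gam D} : AtomicUpdate T → Action Sig Gam D
  | .insert _ T' => .insert (T'.lab T'.root)
  | .update _ T' => .update (T'.lab T'.root)
  | .delete _ => .delete

def Capability.actions (D : Type) : Capability Sig Gam → Set (Action Sig Gam D)
  | .insert _ φ => Action.insert '' φ.sem D
  | .update _ φ => Action.update '' φ.sem D
  | .delete _ => {.delete}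

theorem Capability.mem_sem_iff (T : XMLTree Sig Gam D) (C : Capability Sig Gam)
    (u : AtomicUpdate T) :
    u ∈ C.sem T ↔ u.node ∈ C.path.eval T ∧ u.action ∈ C.actions D := by
  cases C <;> cases u <;>
    simp [Capability.sem, Capability.path, Capability.actions, AtomicUpdate.node,
      AtomicUpdate.action]

/-- The tree with a single node. -/
def XMLTree.leaf (a : Label Sig Gam D) : XMLTree Sig Gam D where
  V := Unit
  finite_V := inferInstance
  E _ _ := False
  root := ()
  lab _ := a
  not_edge_root _ := id
  parent_unique _ _ _ h := h.elim
  reachable _ := .refl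
  leaf_of_not_elem _ _ _ := id

theorem AtomicUpdate.exists_action (T : XMLTree Sig Gam D) (n : T.V) (a : Action Sig Gam D) :
    ∃ u : AtomicUpdate T, u.node = n ∧ u.action = a := by
  cases a with
  | insert a => exact ⟨.insert n (.leaf a), rfl, rfl⟩
  | update a => exact ⟨.update n (.leaf a), rfl, rfl⟩
  | delete => exact ⟨.delete n, rfl, rfl⟩

/-- Whether the policy allows an atomic update, from the capabilities that describe the update. -/
def Policy.Permits (P : Policy Sig Gam) (hit : Capability Sig Gam → Prop) : Prop :=
  match P.ds, P.cr with
  | .allow, .allow => ¬ ((∃ U ∈ P.denied, hit U) ∧ ¬ ∃ U ∈ P.allowed, hit U)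
  | .deny, .allow => ∃ U ∈ P.allowed, hit U
  | .allow, .deny => ¬ ∃ U ∈ P.denied, hit U
  | .deny, .deny => (∃ U ∈ P.allowed, hit U) ∧ ¬ ∃ U ∈ P.denied, hit U

theorem Policy.mem_sem_iff (P : Policy Sig Gam) (T : XMLTree Sig Gam D) (u : AtomicUpdate T) :
    u ∈ P.sem T ↔ P.Permits fun C => u ∈ C.sem T := by
  rcases P with ⟨_ | _, _ | _, A, B⟩ <;>
    simp [Policy.sem, Policy.Permits, capsSem]

def Policy.capabilities (P : Policy Sig Gam) : Set (Capability Sig Gam) :=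
  {C | C ∈ P.allowed ∨ C ∈ P.denied}

theorem Policy.finite_capabilities (P : Policy Sig Gam) : P.capabilities.Finite :=
  P.allowed.finite_toSet.union P.denied.finite_toSet

theorem Policy.permits_congr (P : Policy Sig Gam) {hit hit' : Capability Sig Gam → Prop}
    (h : ∀ C ∈ P.capabilities, hit C ↔ hit' C) : P.Permits hit ↔ P.Permits hit' := by
  have h1 : (∃ U ∈ P.allowed, hit U) ↔ ∃ U ∈ P.allowed, hit' U :=
    exists_congr fun C => and_congr_right fun hC => h C (.inl hC)
  have h2 : (∃ U ∈ P.denied, hit U) ↔ ∃ U ∈ P.denied, hit' U :=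
    exists_congr fun C => and_congr_right fun hC => h C (.inr hC)
  rcases P with ⟨_ | _, _ | _, A, B⟩ <;> simp only [Policy.Permits] <;> simp only [h1, h2]

/-- Whether the policy permits an action at a node, from the type of the root when the node is
marked. -/
def Policy.PermitsAt (P : Policy Sig Gam) (Φ : Set (Form Sig)) (τ : Set Φ)
    (a : Action Sig Gam D) : Prop :=
  P.Permits fun C => a ∈ C.actions D ∧ C.path.form .mark ∈ Subtype.val '' τ

/-- Membership of an update in a capability splits into a condition on its node, read off the root
type, and one on its action. All pairs of node and action occur, by one-node trees. -/
theorem Policy.staticallyAllows_iff (P : Policy Sig Gam) {Φ : Set (Form Sig)}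
    (hP : ∀ C ∈ P.capabilities, C.path.form .mark ∈ Φ) (U : Capability Sig Gam) :
    P.StaticallyAllows D U ↔ ∀ τ ∈ markedTypes Gam D Φ (U.path.form .mark),
      ∀ a ∈ U.actions D, P.PermitsAt Φ τ a := by
  have key : ∀ (T : XMLTree Sig Gam D) (u : AtomicUpdate T),
      u ∈ P.sem T ↔ P.PermitsAt Φ (nodeType Φ T {u.node} T.root) u.action := by
    intro T u
    rw [P.mem_sem_iff]
    refine P.permits_congr fun C hC => ?_
    rw [C.mem_sem_iff, Path.mem_eval_iff, and_comm]
    refine and_congr_right fun _ => ?_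
    simp [nodeType, hP C hC]
  constructor
  · rintro h _ ⟨T, n, hn, rfl⟩ a ha
    obtain ⟨u, rfl, rfl⟩ := AtomicUpdate.exists_action T n a
    exact (key T u).1 (h T ((U.mem_sem_iff T u).2 ⟨(Path.mem_eval_iff _ _ _).2 hn, ha⟩))
  · intro h T u hu
    obtain ⟨hn, ha⟩ := (U.mem_sem_iff T u).1 hu
    exact (key T u).2 (h _ ⟨T, u.node, (Path.mem_eval_iff _ _ _).1 hn, rfl⟩ _ ha)

/-! ### Classes of node tests -/

/-- A node test, with a class instead of the name. -/
inductive TestShape (C : Type) : Type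
  | elem (c : C)
  | any
  | attr (c : C)
  | text
  deriving Fintype

inductive Op : Type
  | insert
  | update
  | delete
  deriving DecidableEq

instance : Fintype Op :=
  ⟨{.insert, .update, .delete}, by rintro ⟨⟩ <;> simp⟩

def NodeTest.shape {C : Type} (cls : Sig → C) (cls' : Gam → C) : NodeTest Sig Gam → TestShape C
  | .elem (.name l) => .elem (cls l)
  | .elem .any => .any
  | .attr f => .attr (cls' f)
  | .text => .text

def Capability.shape {C : Type} (cls : Sig → C) (cls' : Gam → C) :
    Capability Sig Gam → Op × Option (TestShape C)
  | .insert _ φ => (.insert, some (φ.shape cls cls'))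
  | .update _ φ => (.update, some (φ.shape cls cls'))
  | .delete _ => (.delete, none)

def NodeTest.names : NodeTest Sig Gam → Set Sig
  | .elem (.name l) => {l}
  | _ => ∅

def NodeTest.attrs : NodeTest Sig Gam → Set Gam
  | .attr f => {f}
  | _ => ∅

theorem NodeTest.finite_names (φ : NodeTest Sig Gam) : φ.names.Finite := by
  rcases φ with (_ | _) | _ | _ <;> simp [NodeTest.names]

theorem NodeTest.finite_attrs (φ : NodeTest Sig Gam) : φ.attrs.Finite := by
  cases φ <;> simp [NodeTest.attrs]

/-- The node test of a capability; the choice for deletions does not matter. -/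
def Capability.test : Capability Sig Gam → NodeTest Sig Gam
  | .insert _ φ => φ
  | .update _ φ => φ
  | .delete _ => .text

def Policy.names (P : Policy Sig Gam) : Set Sig :=
  ⋃ C ∈ P.capabilities, C.test.names

def Policy.attrs (P : Policy Sig Gam) : Set Gam :=
  ⋃ C ∈ P.capabilities, C.test.attrs

theorem Policy.finite_names (P : Policy Sig Gam) : P.names.Finite :=
  P.finite_capabilities.biUnion fun _ _ => NodeTest.finite_names _

theorem Policy.finite_attrs (P : Policy Sig Gam) : P.attrs.Finite :=
  P.finite_capabilities.biUnion fun _ _ => NodeTest.finite_attrs _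

/-- Exchange the name in `a` for that in `ψ`, keeping the data value. Tests over `K` and `K'` cannot
tell the difference, since the classes agree. -/
theorem NodeTest.exists_label_of_shape_eq {C : Type} {cls : Sig → C} {cls' : Gam → C}
    {K : Set Sig} {K' : Set Gam} (hK : Separates cls K) (hK' : Separates cls' K')
    {φ ψ : NodeTest Sig Gam} (h : φ.shape cls cls' = ψ.shape cls cls') {a : Label Sig Gam D}
    (ha : a ∈ φ.sem D) : ∃ b ∈ ψ.sem D, ∀ χ : NodeTest Sig Gam, χ.names ⊆ K → χ.attrs ⊆ K' →
      (a ∈ χ.sem D ↔ b ∈ χ.sem D) := by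
  rcases φ with (l | _) | f | _ <;> rcases ψ with (l' | _) | f' | _ <;>
    simp only [NodeTest.shape, reduceCtorEq, TestShape.elem.injEq, TestShape.attr.injEq] at h
  · obtain rfl : a = .elem l := ha
    refine ⟨.elem l', rfl, fun χ h1 h2 => ?_⟩
    rcases χ with (k | _) | f | _
    · simpa [NodeTest.sem, StepTest.sem] using hK l l' h k (h1 rfl)
    · simp [NodeTest.sem, StepTest.sem]
    · simp [NodeTest.sem]
    · simp [NodeTest.sem]
  · exact ⟨a, ha, fun _ _ _ => Iff.rfl⟩
  · obtain ⟨d, rfl⟩ : ∃ d, Label.attr f d = a := ha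
    refine ⟨.attr f' d, ⟨d, rfl⟩, fun χ h1 h2 => ?_⟩
    rcases χ with (k | _) | k | _
    · simp [NodeTest.sem, StepTest.sem]
    · simp [NodeTest.sem, StepTest.sem]
    · simpa [NodeTest.sem, eq_comm] using hK' f f' h k (h2 rfl)
    · simp [NodeTest.sem]
  · exact ⟨a, ha, fun _ _ _ => Iff.rfl⟩

theorem Capability.exists_action_of_shape_eq {C : Type} {cls : Sig → C} {cls' : Gam → C}
    {K : Set Sig} {K' : Set Gam} (hK : Separates cls K) (hK' : Separates cls' K')
    {U V : Capability Sig Gam} (h : U.shape cls cls' = V.shape cls cls') {a : Action Sig Gam D}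
    (ha : a ∈ U.actions D) : ∃ b ∈ V.actions D, ∀ W : Capability Sig Gam, W.test.names ⊆ K →
      W.test.attrs ⊆ K' → (a ∈ W.actions D ↔ b ∈ W.actions D) := by
  cases U <;> cases V <;>
    simp only [Capability.shape, Prod.mk.injEq, reduceCtorEq, false_and, true_and,
      Option.some.injEq] at h
  · obtain ⟨x, hx, rfl⟩ := ha
    obtain ⟨y, hy, hxy⟩ := NodeTest.exists_label_of_shape_eq hK hK' h hx
    refine ⟨.insert y, ⟨y, hy, rfl⟩, fun W h1 h2 => ?_⟩
    cases W <;> simp [Capability.actions]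
    exact hxy _ h1 h2
  · obtain ⟨x, hx, rfl⟩ := ha
    obtain ⟨y, hy, hxy⟩ := NodeTest.exists_label_of_shape_eq hK hK' h hx
    refine ⟨.update y, ⟨y, hy, rfl⟩, fun W h1 h2 => ?_⟩
    cases W <;> simp [Capability.actions]
    exact hxy _ h1 h2
  · exact ⟨a, ha, fun _ _ _ => Iff.rfl⟩

/-- The decision about the capabilities of a given shape whose paths have given marked types. -/
def Policy.Decision {C : Type} (D : Type) (P : Policy Sig Gam) (Φ : Set (Form Sig))
    (cls : Sig → C) (cls' : Gam → C) (s : Op × Option (TestShape C)) (R : Set (Set Φ)) : Prop :=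
  ∀ V : Capability Sig Gam, V.shape cls cls' = s → ∀ τ ∈ R, ∀ a ∈ V.actions D, P.PermitsAt Φ τ a

/-- `Policy.Decision` quantifies over all capabilities of a shape, so that it depends on finite data
only. Nothing is lost: actions of equal shapes match up to what the policy can distinguish. -/
theorem Policy.staticallyAllows_iff_decision {C : Type} (P : Policy Sig Gam) {Φ : Set (Form Sig)}
    (hP : ∀ C ∈ P.capabilities, C.path.form .mark ∈ Φ) {cls : Sig → C} {cls' : Gam → C}
    (hcls : Separates cls P.names) (hcls' : Separates cls' P.attrs) (U : Capability Sig Gam) :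
    P.StaticallyAllows D U ↔ P.Decision D Φ cls cls' (U.shape cls cls')
      (markedTypes Gam D Φ (U.path.form .mark)) := by
  rw [P.staticallyAllows_iff hP]
  constructor
  · intro h V hV τ hτ a ha
    obtain ⟨b, hb, hab⟩ := Capability.exists_action_of_shape_eq hcls hcls' hV ha
    refine (P.permits_congr fun W hW => ?_).2 (h τ hτ b hb)
    rw [hab W (Set.subset_biUnion_of_mem (u := fun C => C.test.names) hW)
      (Set.subset_biUnion_of_mem (u := fun C => C.test.attrs) hW)]
  · exact fun h => h U rfl

end

/-! ### A stack machine

Four working stacks: the input, the pending parts of the expression, the open pattern nodes, and an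
auxiliary stack for words; and an output stack. -/

inductive TodoSym : Type
  | path
  | filter
  | close (opened : Bool)

/-- Symbols for open pattern nodes: the class of the name and the value of the requirements, the bits
of the name, and separators between a node and its parent, which tell whether the parent is the node
where the current filter starts. -/
inductive NodeSym (C A : Type) : Type
  | head (k : Option C) (a : A)
  | bit (b : Bool)
  | sep (last : Bool)

set_option synthInstance.maxSize 1024 in
set_option synthInstance.maxHeartbeats 400000 in
/-- Program counters, with the registers that are in use. -/
inductive Pc (C A : Type) : Type
  | start
  | init
  | readPath
  | addPath
  | addFilter
  | openSep
  | openHead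
  | readTest
  | getHead
  | load (c : C) (a : A)
  | loadPush (c : C) (a : A) (b : Bool)
  | unload (c : C) (a : A)
  | unloadPush (c : C) (a : A) (b : Bool)
  | putHead (c : C) (a : A)
  | cmp (c : C) (a : A)
  | cmpNode (c : C) (a : A) (b : Bool)
  | cmpPush (c : C) (a : A) (b : Bool)
  | cmpEnd (c : C) (a : A)
  | cmpSep (c : C) (a : A) (last : Bool)
  | ret
  | readFilter
  | addConj
  | addClose
  | collapse (b : Bool)
  | discard (b : Bool) (r : A)
  | merge (b : Bool) (r : A) (last : Bool)
  | mergePush (b : Bool) (last : Bool) (k : Option C) (a : A)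
  | finish
  | unwind (r : A)
  | unwindHead (r : A)
  | readNode (r : A)
  | readName (isAttr : Bool) (c : C) (r : A)
  | cleanInp (b : Bool)
  | cleanTodo (b : Bool)
  | cleanNodes (b : Bool)
  | cleanTmp (b : Bool)
  | output (b : Bool)
  | halted
  deriving Fintype

/-- States: the program counter, the kind of the capability, and whether a pattern node has been
opened since the start of the current filter. -/
structure State (C A : Type) : Type where
  pc : Pc C A
  op : Op
  opened : Bool

instance {C A : Type} [Finite C] [Finite A] : Finite (State C A) :=
  have := Fintype.ofFinite C
  have := Fintype.ofFinite A
  Finite.of_injective (fun s : State C A => (s.pc, s.op, s.opened)) fun s s' h => by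
    cases s
    cases s'
    simp_all

/-- The elementary instructions of the machine. -/
inductive Instr (C A : Type) : Type
  | popInp (f : Option Token → State C A)
  | popTodo (f : Option TodoSym → State C A)
  | popNodes (f : Option (NodeSym C A) → State C A)
  | popTmp (f : Option Bool → State C A)
  | pushTodo (x : TodoSym) (s : State C A)
  | pushNodes (x : NodeSym C A) (s : State C A)
  | pushTmp (x : Bool) (s : State C A)
  | pushOut (x : Bool) (s : State C A)
  | halt

/-- The operations on finite domains that the machine uses. -/
structure Algebra (C A : Type) : Type where
  empty : A
  close : Option C → A → A
  closeMarked : Option C → A → A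
  add : A → A → A
  nil : C
  snoc : C → Bool → C
  decision : Op × Option (TestShape C) → A → Bool

section

variable {C A : Type}

def State.goto (s : State C A) (pc : Pc C A) : State C A :=
  { s with pc := pc }

/-- Stop and accept. -/
def State.accept (s : State C A) : State C A :=
  s.goto (.cleanInp true)

/-- The program. -/
def instr (S : Algebra C A) (s : State C A) : Instr C A :=
  match s.pc with
  | .start => .popInp fun
    | some .insert => { s with pc := .init, op := .insert, opened := false }
    | some .update => { s with pc := .init, op := .update, opened := false }
    | some .delete => { s with pc := .init, op := .delete, opened := false }
    -- Accepting is the right answer only for contradictory names; on other unexpected symbols the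
    -- answer is irrelevant, as the input encodes a capability without descendant steps.
    | _ => s.accept
  | .init => .pushNodes (.head none S.empty) (s.goto .readPath)
  | .readPath => .popInp fun
    | some .self => s.goto .readTest
    | some .child => s.goto .openSep
    | some .comp => s.goto .addPath
    | some .filter => s.goto .addFilter
    | _ => s.accept
  | .addPath => .pushTodo .path (s.goto .readPath)
  | .addFilter => .pushTodo .filter (s.goto .readPath)
  -- If no node has been opened yet, the parent is the node where the current filter or the main
  -- path starts.
  | .openSep => .pushNodes (.sep !s.opened) { s with pc := .openHead, opened := true }
  | .openHead => .pushNodes (.head none S.empty) (s.goto .readTest)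
  | .readTest => .popInp fun
    | some .any => s.goto .ret
    | some .name => s.goto .getHead
    | _ => s.accept
  | .getHead => .popNodes fun
    | some (.head none a) => s.goto (.load S.nil a)
    | some (.head (some c) a) => s.goto (.cmp c a)
    | _ => s.accept
  | .load c a => .popInp fun
    | some (.bit b) => s.goto (.loadPush (S.snoc c b) a b)
    | some .endName => s.goto (.unload c a)
    | _ => s.accept
  | .loadPush c a b => .pushTmp b (s.goto (.load c a))
  | .unload c a => .popTmp fun
    | some b => s.goto (.unloadPush c a b)
    | none => s.goto (.putHead c a)
  | .unloadPush c a b => .pushNodes (.bit b) (s.goto (.unload c a))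
  | .putHead c a => .pushNodes (.head (some c) a) (s.goto .ret)
  | .cmp c a => .popInp fun
    | some (.bit b) => s.goto (.cmpNode c a b)
    | some .endName => s.goto (.cmpEnd c a)
    | _ => s.accept
  | .cmpNode c a b => .popNodes fun
    | some (.bit b') => if b = b' then s.goto (.cmpPush c a b) else s.accept
    -- The stored name is a proper prefix of the name that is read.
    | _ => s.accept
  | .cmpPush c a b => .pushTmp b (s.goto (.cmp c a))
  | .cmpEnd c a => .popNodes fun
    -- The names agree only if the stored one ends here too, at the bottom of the stack or at a
    -- separator.
    | none => s.goto (.unload c a)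
    | some (.sep last) => s.goto (.cmpSep c a last)
    | _ => s.accept
  | .cmpSep c a last => .pushNodes (.sep last) (s.goto (.unload c a))
  | .ret => .popTodo fun
    | none => s.goto .finish
    | some .path => s.goto .readPath
    | some .filter => s.goto .readFilter
    -- End of a filter. Its branch is collapsed if it has left the starting node; `b` restores the
    -- flag of the enclosing path.
    | some (.close b) => if s.opened then s.goto (.collapse b) else { s with opened := b }
  | .readFilter => .popInp fun
    | some .path => s.goto .addClose
    | some .conj => s.goto .addConj
    | some .tt => s.goto .ret
    | _ => s.accept
  | .addConj => .pushTodo .filter (s.goto .readFilter)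
  | .addClose => .pushTodo (.close s.opened) { s with pc := .readPath, opened := false }
  | .collapse b => .popNodes fun
    | some (.head k a) => s.goto (.discard b (S.close k a))
    | _ => s.accept
  | .discard b r => .popNodes fun
    | some (.bit _) => s
    | some (.sep last) => s.goto (.merge b r last)
    | _ => s.accept
  | .merge b r last => .popNodes fun
    | some (.head k a) => s.goto (.mergePush b last k (S.add a r))
    | _ => s.accept
  | .mergePush b last k a => .pushNodes (.head k a)
    (if last then { s with pc := .ret, opened := b } else s.goto (.collapse b))
  | .finish => .popNodes fun
    | some (.head k a) => s.goto (.unwind (S.closeMarked k a))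
    | _ => s.accept
  | .unwind r => .popNodes fun
    | some (.bit _) => s
    | some (.sep _) => s.goto (.unwindHead r)
    | none =>
      match s.op with
      | .delete => s.goto (.cleanInp (S.decision (.delete, none) r))
      | _ => s.goto (.readNode r)
    | _ => s.accept
  | .unwindHead r => .popNodes fun
    | some (.head k a) => s.goto (.unwind (S.close k (S.add a r)))
    | _ => s.accept
  | .readNode r => .popInp fun
    | some .any => s.goto (.cleanInp (S.decision (s.op, some .any) r))
    | some .text => s.goto (.cleanInp (S.decision (s.op, some .text) r))
    | some .name => s.goto (.readName false S.nil r)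
    | some .attr => s.goto (.readName true S.nil r)
    | _ => s.accept
  | .readName isAttr c r => .popInp fun
    | some (.bit b) => s.goto (.readName isAttr (S.snoc c b) r)
    | some .endName =>
      s.goto (.cleanInp (S.decision (s.op, some (if isAttr then .attr c else .elem c)) r))
    | _ => s.accept
  | .cleanInp b => .popInp fun
    | some _ => s
    | none => s.goto (.cleanTodo b)
  | .cleanTodo b => .popTodo fun
    | some _ => s
    | none => s.goto (.cleanNodes b)
  | .cleanNodes b => .popNodes fun
    | some _ => s
    | none => s.goto (.cleanTmp b)
  | .cleanTmp b => .popTmp fun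
    | some _ => s
    | none => s.goto (.output b)
  | .output b => .pushOut b (s.goto .halted)
  | .halted => .halt

/-- Configurations of the machine. -/
structure Conf (C A : Type) : Type where
  state : State C A
  inp : List Token
  todo : List TodoSym
  nodes : List (NodeSym C A)
  tmp : List Bool
  out : List Bool

def Conf.step (S : Algebra C A) (c : Conf C A) : Option (Conf C A) :=
  match instr S c.state with
  | .popInp f => some { c with state := f c.inp.head?, inp := c.inp.tail }
  | .popTodo f => some { c with state := f c.todo.head?, todo := c.todo.tail }
  | .popNodes f => some { c with state := f c.nodes.head?, nodes := c.nodes.tail }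
  | .popTmp f => some { c with state := f c.tmp.head?, tmp := c.tmp.tail }
  | .pushTodo x s => some { c with state := s, todo := x :: c.todo }
  | .pushNodes x s => some { c with state := s, nodes := x :: c.nodes }
  | .pushTmp x s => some { c with state := s, tmp := x :: c.tmp }
  | .pushOut x s => some { c with state := s, out := x :: c.out }
  | .halt => none

/-! ### Running time -/

/-- The contribution of the program counter to the potential. -/
def Pc.rank : Pc C A → ℕ
  | .start => 6
  | .init => 25
  | .readPath => 10
  | .addPath => 220
  | .addFilter => 220
  | .openSep => 40
  | .openHead => 25
  | .readTest => 10
  | .getHead => 10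
  | .load _ _ => 10
  | .loadPush _ _ _ => 31
  | .unload _ _ => 21
  | .unloadPush _ _ _ => 32
  | .putHead _ _ => 20
  | .cmp _ _ => 10
  | .cmpNode _ _ _ => 22
  | .cmpPush _ _ _ => 31
  | .cmpEnd _ _ => 23
  | .cmpSep _ _ _ => 32
  | .ret => 9
  | .readFilter => 10
  | .addConj => 220
  | .addClose => 220
  | .collapse _ => 20
  | .discard _ _ => 20
  | .merge _ _ _ => 22
  | .mergePush _ _ _ _ => 31
  | .finish => 8
  | .unwind _ => 7
  | .unwindHead _ => 8
  | .readNode _ => 6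
  | .readName _ _ _ => 6
  | .cleanInp _ => 5
  | .cleanTodo _ => 4
  | .cleanNodes _ => 3
  | .cleanTmp _ => 2
  | .output _ => 1
  | .halted => 0

/-- A potential that decreases at every step. -/
def Conf.potential (c : Conf C A) : ℕ :=
  -- An input symbol pays for the symbols pushed in response to it. A bit on `tmp` weighs more than
  -- one on `nodes`, so that moving it back there still lowers the potential.
  300 * c.inp.length + 200 * c.todo.length + 10 * c.nodes.length + 20 * c.tmp.length +
    c.state.pc.rank

theorem Conf.potential_lt_of_step (S : Algebra C A) {c c' : Conf C A}
    (h : c.step S = some c') : c'.potential < c.potential := by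
  obtain ⟨⟨pc, op, o⟩, inp, todo, nodes, tmp, out⟩ := c
  cases pc
  all_goals
    simp only [Conf.step, instr, Option.some.injEq, reduceCtorEq] at h
  all_goals subst h
  all_goals simp only [Conf.potential, List.length_tail, List.length_cons]
  case start | readPath | readTest | load | cmp | readFilter | readNode | readName | cleanInp =>
    rcases inp with _ | ⟨x, inp⟩ <;> [skip; cases x] <;>
      simp only [List.head?_nil, List.head?_cons, List.length_nil, List.length_cons,
        State.goto, State.accept, Pc.rank] <;> omega
  case ret | cleanTodo =>
    rcases todo with _ | ⟨x, todo⟩ <;> [skip; cases x] <;>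
      simp only [List.head?_nil, List.head?_cons, List.length_nil, List.length_cons,
        State.goto] <;> (try split_ifs) <;> simp only [Pc.rank] <;> omega
  case getHead | cmpNode | cmpEnd | collapse | discard | merge | finish | unwind | unwindHead |
      cleanNodes =>
    rcases nodes with _ | ⟨⟨_ | _, _⟩ | _ | _, nodes⟩ <;> (try cases op) <;>
      simp only [List.head?_nil, List.head?_cons, List.length_nil, List.length_cons,
        State.goto, State.accept] <;> (try split_ifs) <;> simp only [Pc.rank] <;> omega
  case unload | cleanTmp =>
    rcases tmp with _ | ⟨x, tmp⟩ <;>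
      simp only [List.head?_nil, List.head?_cons, List.length_nil, List.length_cons,
        State.goto, Pc.rank] <;> omega
  all_goals
    (try simp only [State.goto]); (try split_ifs) <;> simp only [Pc.rank] <;> omega

end

section

variable {C A : Type}

/-! ### Correctness of the machine -/

def Reaches (S : Algebra C A) : Conf C A → Conf C A → Prop :=
  Relation.ReflTransGen fun c c' => c.step S = some c'

theorem Reaches.step {S : Algebra C A} {c c' c'' : Conf C A} (h' : Reaches S c' c'')
    (h : c.step S = some c') : Reaches S c c'' :=
  .head h h'

theorem Reaches.trans {S : Algebra C A} {c c' c'' : Conf C A} (h : Reaches S c c')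
    (h' : Reaches S c' c'') : Reaches S c c'' :=
  Relation.ReflTransGen.trans h h'

/-- The machine reaches the configuration `k x` if `o` is `some x`, and accepts if `o` is `none`. -/
def Yields (S : Algebra C A) {α : Type} (c : Conf C A) (o : Option α) (k : α → Conf C A) : Prop :=
  match o with
  | some x => Reaches S c (k x)
  | none => ∃ c', Reaches S c c' ∧ c'.state.pc = .cleanInp true ∧ c'.out = []

theorem Yields.of_reaches {S : Algebra C A} {α : Type} {c c' : Conf C A} {o : Option α}
    {k : α → Conf C A} (h' : Yields S c' o k) (h : Reaches S c c') : Yields S c o k := by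
  cases o with
  | none => exact h'.imp fun _ h'' => ⟨h.trans h''.1, h''.2⟩
  | some x => exact h.trans h'

theorem Yields.bind {S : Algebra C A} {α β : Type} {c : Conf C A} {o : Option α}
    {k : α → Conf C A} {g : α → Option β} {k' : β → Conf C A} (h : Yields S c o k)
    (h' : ∀ x ∈ o, Yields S (k x) (g x) k') : Yields S c (o.bind g) k' := by
  cases o with
  | none => exact h
  | some x => exact (h' x rfl).of_reaches h

theorem Yields.map {S : Algebra C A} {α β : Type} {c : Conf C A} {o : Option α}
    {g : α → β} {k : β → Conf C A} (h : Yields S c o fun x => k (g x)) :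
    Yields S c (o.map g) k := by
  cases o with
  | none => exact h
  | some x => exact h

theorem reaches_load (S : Algebra C A) (op : Op) (o : Bool) (a : A) (s : List Token)
    (K : List TodoSym) (ν : List (NodeSym C A)) (w : List Bool) :
    ∀ (c : C) (t : List Bool),
      Reaches S ⟨⟨.load c a, op, o⟩, nameTokens w ++ s, K, ν, t, []⟩
        ⟨⟨.unload (w.foldl S.snoc c) a, op, o⟩, s, K, ν, w.reverse ++ t, []⟩ := by
  induction w with
  | nil => exact fun c t => Reaches.step .refl rfl
  | cons b w ih =>
    intro c t
    rw [show (b :: w).reverse ++ t = w.reverse ++ b :: t by simp]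
    exact .step (.step (ih (S.snoc c b) (b :: t)) rfl) rfl

/-- Moving bits from `tmp` to `nodes` reverses them again, so the name is stored in reading order
and the next comparison meets its first bit on top. -/
theorem reaches_unload (S : Algebra C A) (op : Op) (o : Bool) (c : C) (a : A) (s : List Token)
    (K : List TodoSym) (t : List Bool) :
    ∀ ν : List (NodeSym C A), Reaches S ⟨⟨.unload c a, op, o⟩, s, K, ν, t, []⟩
      ⟨⟨.ret, op, o⟩, s, K, .head (some c) a :: (t.reverse.map .bit ++ ν), [], []⟩ := by
  induction t with
  | nil => exact fun ν => .step (.step .refl rfl) rfl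
  | cons b t ih =>
    intro ν
    rw [show (b :: t).reverse.map NodeSym.bit ++ ν = t.reverse.map .bit ++ .bit b :: ν by simp]
    exact .step (.step (ih (.bit b :: ν)) rfl) rfl

theorem reaches_unload_reverse (S : Algebra C A) (op : Op) (o : Bool) (c : C) (a : A)
    (s : List Token) (K : List TodoSym) (ν : List (NodeSym C A)) (w : List Bool) :
    Reaches S ⟨⟨.unload c a, op, o⟩, s, K, ν, w.reverse ++ [], []⟩
      ⟨⟨.ret, op, o⟩, s, K, .head (some c) a :: (w.map .bit ++ ν), [], []⟩ := by
  have h := reaches_unload S op o c a s K w.reverse ν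
  rw [List.reverse_reverse] at h
  rwa [List.append_nil]

/-- Stack contents below the bits of a name. -/
def EndsName (ρ : List (NodeSym C A)) : Prop :=
  ρ = [] ∨ ∃ last ρ', ρ = .sep last :: ρ'

/-- Bits are popped in step with the input and saved on `tmp`, from where they are restored. The
cost is thus bounded by the name read, however long the stored name is. -/
theorem yields_cmp (S : Algebra C A) (op : Op) (o : Bool) (c : C) (a : A) (s : List Token)
    (K : List TodoSym) {ρ : List (NodeSym C A)} (hρ : EndsName ρ) {α : Type} (x : α)
    (w : List Bool) : ∀ u t : List Bool,
      Yields S ⟨⟨.cmp c a, op, o⟩, nameTokens w ++ s, K, u.map .bit ++ ρ, t, []⟩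
        (if w = u then some x else none)
        (fun _ => ⟨⟨.unload c a, op, o⟩, s, K, ρ, w.reverse ++ t, []⟩) := by
  induction w with
  | nil =>
    rintro (_ | ⟨b, u⟩) t
    · rw [if_pos rfl]
      rcases hρ with rfl | ⟨last, ρ', rfl⟩
      · exact Reaches.step (.step .refl rfl) rfl
      · exact Reaches.step (.step (.step .refl rfl) rfl) rfl
    · rw [if_neg (by simp)]
      exact ⟨_, Reaches.step (.step .refl rfl) rfl, rfl, rfl⟩
  | cons b w ih =>
    rintro (_ | ⟨b', u⟩) t
    · rw [if_neg (by simp)]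
      rcases hρ with rfl | ⟨last, ρ', rfl⟩
      · exact ⟨_, Reaches.step (.step .refl rfl) rfl, rfl, rfl⟩
      · exact ⟨_, Reaches.step (.step .refl rfl) rfl, rfl, rfl⟩
    · by_cases hb : b = b'
      · subst hb
        have h := ih u (b :: t)
        simp only [List.cons.injEq, true_and]
        refine Yields.of_reaches (c' := ⟨⟨.cmp c a, op, o⟩, nameTokens w ++ s, K,
          u.map .bit ++ ρ, b :: t, []⟩) ?_ ?_
        · simpa using h
        · refine .step (c' := ⟨⟨.cmpNode c a b, op, o⟩, nameTokens w ++ s, K,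
            .bit b :: (u.map .bit ++ ρ), t, []⟩) (.step (c' := ⟨⟨.cmpPush c a b, op, o⟩,
            nameTokens w ++ s, K, u.map .bit ++ ρ, t, []⟩) (.step .refl rfl) ?_) rfl
          simp [Conf.step, instr, State.goto]
      · rw [if_neg (by simp [hb])]
        refine ⟨⟨⟨.cleanInp true, op, o⟩, nameTokens w ++ s, K, u.map .bit ++ ρ, t, []⟩,
          .step (c' := ⟨⟨.cmpNode c a b, op, o⟩, nameTokens w ++ s, K,
            .bit b' :: (u.map .bit ++ ρ), t, []⟩) (.step .refl ?_) rfl, rfl, rfl⟩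
        simp [Conf.step, instr, State.goto, State.accept, hb]

end

-- Tree patterns on the stacks, and the evaluation of capabilities

section

variable {Sig Gam D C A : Type}

/-- Representation of names and requirements on the stacks. -/
structure StackRepr (Sig C A : Type) (S : Algebra C A) : Type where
  enc : Sig → List Bool
  enc_injective : Function.Injective enc
  val : List (Form Sig) → A
  val_nil : val [] = S.empty

variable {S : Algebra C A} (r : StackRepr Sig C A S)

def StackRepr.cls (l : Sig) : C :=
  (r.enc l).foldl S.snoc S.nil

/-- Adding a pattern node without mark to the requirements of its parent. -/
def StackRepr.Compatible : Prop :=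
  ∀ (f : Frame Sig) (gs : List (Form Sig)),
    r.val (f.form .tt :: gs) = S.add (r.val gs) (S.close (f.name.map r.cls) (r.val f.reqs))

def StackRepr.bits (k : Option Sig) : List (NodeSym C A) :=
  (k.elim [] r.enc).map .bit

/-- A pattern node on top of a stack. -/
def StackRepr.push (f : Frame Sig) (ρ : List (NodeSym C A)) : List (NodeSym C A) :=
  .head (f.name.map r.cls) (r.val f.reqs) :: (r.bits f.name ++ ρ)

/-- The ancestors of a pattern node on top of a stack. -/
def StackRepr.pushAncestors : List (Frame Sig) → List (NodeSym C A) → List (NodeSym C A)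
  | [], ρ => ρ
  | g :: gs, ρ => .sep gs.isEmpty :: r.push g (pushAncestors gs ρ)

theorem StackRepr.endsName_pushAncestors {ρ : List (NodeSym C A)} (hρ : EndsName ρ) :
    ∀ gs : List (Frame Sig), EndsName (r.pushAncestors gs ρ)
  | [] => hρ
  | _ :: _ => .inr ⟨_, _, rfl⟩

theorem StackRepr.yields_readTest (op : Op) (o : Bool) (t : StepTest Sig) (f : Frame Sig)
    (s : List Token) (K : List TodoSym) {ρ : List (NodeSym C A)} (hρ : EndsName ρ) :
    Yields S ⟨⟨.readTest, op, o⟩, t.tokens r.enc ++ s, K, r.push f ρ, [], []⟩ (f.restrict t)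
      (fun f' => ⟨⟨.ret, op, o⟩, s, K, r.push f' ρ, [], []⟩) := by
  obtain ⟨k, gs⟩ := f
  rcases t with l | _
  · rcases k with _ | k
    · exact Reaches.step (.step ((reaches_load S op o _ s K ρ (r.enc l) S.nil []).trans
        (reaches_unload_reverse S op o (r.cls l) (r.val gs) s K ρ (r.enc l))) rfl) rfl
    · have h := yields_cmp S op o (r.cls k) (r.val gs) s K hρ (⟨some k, gs⟩ : Frame Sig)
        (r.enc l) (r.enc k) []
      by_cases hlk : l = k
      · subst hlk
        rw [if_pos rfl] at h
        simp only [Frame.restrict, if_true]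
        exact Reaches.step (.step (Reaches.trans h
          (reaches_unload_reverse S op o (r.cls l) (r.val gs) s K ρ (r.enc l))) rfl) rfl
      · rw [if_neg (r.enc_injective.ne hlk)] at h
        simp only [Frame.restrict, if_neg hlk]
        obtain ⟨c', hc, hc'⟩ := h
        exact ⟨c', .step (.step hc rfl) rfl, hc'⟩
  · exact Reaches.step .refl rfl

theorem StackRepr.reaches_discard (op : Op) (o b : Bool) (x : A) (s : List Token) (K : List TodoSym)
    (ρ : List (NodeSym C A)) (w : List Bool) :
    Reaches S ⟨⟨.discard b x, op, o⟩, s, K, w.map .bit ++ ρ, [], []⟩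
      ⟨⟨.discard b x, op, o⟩, s, K, ρ, [], []⟩ := by
  induction w with
  | nil => exact .refl
  | cons _ w ih => exact ih.step rfl

theorem StackRepr.reaches_unwind (op : Op) (o : Bool) (x : A) (s : List Token) (K : List TodoSym)
    (ρ : List (NodeSym C A)) (w : List Bool) :
    Reaches S ⟨⟨.unwind x, op, o⟩, s, K, w.map .bit ++ ρ, [], []⟩
      ⟨⟨.unwind x, op, o⟩, s, K, ρ, [], []⟩ := by
  induction w with
  | nil => exact .refl
  | cons _ w ih => exact ih.step rfl

/-- Each closed node is reduced to its value and its name discarded; by `Compatible`, adding this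
value to the parent represents the additional requirement. The separator tells when the start of the
filter has been reached. -/
theorem StackRepr.reaches_collapse (hr : r.Compatible) (op : Op) (b : Bool) (s : List Token)
    (K : List TodoSym) (ρ : List (NodeSym C A)) (gs : List (Frame Sig)) :
    ∀ f g : Frame Sig, Reaches S
      ⟨⟨.collapse b, op, true⟩, s, K, r.push f (r.pushAncestors (g :: gs) ρ), [], []⟩
      ⟨⟨.ret, op, b⟩, s, K, r.push (collapse f (g :: gs)) ρ, [], []⟩ := by
  have key : ∀ (f g : Frame Sig) (gs : List (Frame Sig)), Reaches S
      ⟨⟨.collapse b, op, true⟩, s, K, r.push f (r.pushAncestors (g :: gs) ρ), [], []⟩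
      ⟨if gs.isEmpty then ⟨.ret, op, b⟩ else ⟨.collapse b, op, true⟩, s, K,
        r.push ⟨g.name, f.form .tt :: g.reqs⟩ (r.pushAncestors gs ρ), [], []⟩ := by
    intro f g gs
    refine .step ((StackRepr.reaches_discard op true b _ s K _ _).trans
      (.step (.step (.step .refl ?_) rfl) rfl)) rfl
    simp only [StackRepr.push, hr f]
    rfl
  induction gs with
  | nil => exact fun f g => key f g []
  | cons h gs ih => exact fun f g => (key f g (h :: gs)).trans (ih _ h)

mutual
-- The machine follows `Path.exec`: `K` and `ρ` are the contexts that stay untouched, and the flag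
-- records whether the branch `fs` is nonempty.
theorem StackRepr.yields_path (hr : r.Compatible) (op : Op) :
    ∀ (p : Path Sig), p.DescendantFree → ∀ (f : Frame Sig) (fs : List (Frame Sig)) (s : List Token)
      (K : List TodoSym) {ρ : List (NodeSym C A)}, EndsName ρ →
      Yields S ⟨⟨.readPath, op, !fs.isEmpty⟩, p.tokens r.enc ++ s, K,
          r.push f (r.pushAncestors fs ρ), [], []⟩ (p.exec f fs)
        (fun x => ⟨⟨.ret, op, !x.2.isEmpty⟩, s, K, r.push x.1 (r.pushAncestors x.2 ρ), [], []⟩)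
  | .step .self t, _, f, fs, s, K, ρ, hρ => by
    rw [Path.exec]
    refine Yields.map (.of_reaches (r.yields_readTest op (!fs.isEmpty) t f s K
      (r.endsName_pushAncestors hρ fs)) (.step .refl rfl))
  | .step .child t, _, f, fs, s, K, ρ, hρ => by
    rw [Path.exec]
    refine Yields.map (.of_reaches (r.yields_readTest op true t ⟨none, []⟩ s K
      (r.endsName_pushAncestors hρ (f :: fs))) (.step (.step (.step .refl ?_) rfl) rfl))
    simp only [StackRepr.push, r.val_nil]
    cases fs <;> rfl
  | .comp p p', h, f, fs, s, K, ρ, hρ => by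
    rw [Path.exec, Path.tokens, List.cons_append, List.append_assoc]
    refine ((StackRepr.yields_path hr op p h.1 f fs (p'.tokens r.enc ++ s) (.path :: K) hρ).of_reaches
      (.step (.step .refl rfl) rfl)).bind fun x _ => ?_
    exact (StackRepr.yields_path hr op p' h.2 x.1 x.2 s K hρ).of_reaches (.step .refl rfl)
  | .filter p q, h, f, fs, s, K, ρ, hρ => by
    rw [Path.exec, Path.tokens, List.cons_append, List.append_assoc]
    refine ((StackRepr.yields_path hr op p h.1 f fs (q.tokens r.enc ++ s) (.filter :: K) hρ).of_reaches
      (.step (.step .refl rfl) rfl)).bind fun x _ => ?_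
    exact (StackRepr.yields_filter hr op q h.2 x.1 x.2 s K hρ).of_reaches (.step .refl rfl)

theorem StackRepr.yields_filter (hr : r.Compatible) (op : Op) :
    ∀ (q : Filter Sig), q.DescendantFree → ∀ (f : Frame Sig) (fs : List (Frame Sig))
      (s : List Token) (K : List TodoSym) {ρ : List (NodeSym C A)}, EndsName ρ →
      Yields S ⟨⟨.readFilter, op, !fs.isEmpty⟩, q.tokens r.enc ++ s, K,
          r.push f (r.pushAncestors fs ρ), [], []⟩ (q.exec f fs)
        (fun x => ⟨⟨.ret, op, !x.2.isEmpty⟩, s, K, r.push x.1 (r.pushAncestors x.2 ρ), [], []⟩)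
  | .path p, h, f, fs, s, K, ρ, hρ => by
    rw [Filter.exec, Option.map_eq_bind]
    refine ((StackRepr.yields_path hr op p h f [] s (.close (!fs.isEmpty) :: K)
      (r.endsName_pushAncestors hρ fs)).of_reaches (.step (.step .refl rfl) rfl)).bind fun x _ => ?_
    obtain ⟨f', _ | ⟨g, gs⟩⟩ := x
    · exact Reaches.step .refl rfl
    · exact Reaches.step (r.reaches_collapse hr op (!fs.isEmpty) s K _ gs f' g) rfl
  | .conj q q', h, f, fs, s, K, ρ, hρ => by
    rw [Filter.exec, Filter.tokens, List.cons_append, List.append_assoc]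
    refine ((StackRepr.yields_filter hr op q h.1 f fs (q'.tokens r.enc ++ s) (.filter :: K)
      hρ).of_reaches (.step (.step .refl rfl) rfl)).bind fun x _ => ?_
    exact (StackRepr.yields_filter hr op q' h.2 x.1 x.2 s K hρ).of_reaches (.step .refl rfl)
  | .tt, h, f, fs, s, K, ρ, hρ => Reaches.step .refl rfl
end

/-- The value of an open branch, from the value of its last node. -/
def StackRepr.unwind : A → List (Frame Sig) → A
  | x, [] => x
  | x, g :: gs => unwind (S.close (g.name.map r.cls) (S.add (r.val g.reqs) x)) gs

/-- The value of a tree pattern whose last node on the open branch is marked. -/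
def StackRepr.branchValue (x : Frame Sig × List (Frame Sig)) : A :=
  r.unwind (S.closeMarked (x.1.name.map r.cls) (r.val x.1.reqs)) x.2

theorem StackRepr.reaches_unwind_ancestors (op : Op) (o : Bool) (s : List Token) (K : List TodoSym)
    (fs : List (Frame Sig)) : ∀ (x : A) (w : List Bool), Reaches S
      ⟨⟨.unwind x, op, o⟩, s, K, w.map .bit ++ r.pushAncestors fs [], [], []⟩
      ⟨⟨.unwind (r.unwind x fs), op, o⟩, s, K, [], [], []⟩ := by
  induction fs with
  | nil => exact fun x w => StackRepr.reaches_unwind op o x s K [] w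
  | cons g gs ih =>
    exact fun x w => (StackRepr.reaches_unwind op o x s K _ w).trans (.step (.step (ih _ _) rfl) rfl)

theorem StackRepr.reaches_finish (op : Op) (o : Bool) (s : List Token)
    (x : Frame Sig × List (Frame Sig)) :
    Reaches S ⟨⟨.ret, op, o⟩, s, [], r.push x.1 (r.pushAncestors x.2 []), [], []⟩
      ⟨⟨.unwind (r.branchValue x), op, o⟩, s, [], [], [], []⟩ :=
  .step (.step (r.reaches_unwind_ancestors op o s [] x.2 _ _) rfl) rfl

theorem reaches_readName (S : Algebra C A) (op : Op) (o isAttr : Bool) (x : A) (w : List Bool) :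
    ∀ c : C, Reaches S ⟨⟨.readName isAttr c x, op, o⟩, nameTokens w, [], [], [], []⟩
      ⟨⟨.cleanInp (S.decision (op, some (if isAttr then .attr (w.foldl S.snoc c)
        else .elem (w.foldl S.snoc c))) x), op, o⟩, [], [], [], [], []⟩ := by
  induction w with
  | nil => exact fun c => .step .refl rfl
  | cons b w ih => exact fun c => .step (ih (S.snoc c b)) rfl

theorem StackRepr.reaches_readNode (op : Op) (o : Bool) (x : A) (encGam : Gam → List Bool)
    (φ : NodeTest Sig Gam) :
    Reaches S ⟨⟨.readNode x, op, o⟩, φ.tokens r.enc encGam, [], [], [], []⟩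
      ⟨⟨.cleanInp (S.decision (op, some (φ.shape r.cls
        fun f => (encGam f).foldl S.snoc S.nil)) x), op, o⟩, [], [], [], [], []⟩ := by
  rcases φ with (l | _) | f | _
  · exact .step (reaches_readName S op o false x (r.enc l) S.nil) rfl
  · exact .step .refl rfl
  · exact .step (reaches_readName S op o true x (encGam f) S.nil) rfl
  · exact .step .refl rfl

/-- The answer of the machine, when its input is the given capability. -/
noncomputable def StackRepr.answer (encGam : Gam → List Bool) (U : Capability Sig Gam) : Bool :=
  match U.path.exec ⟨none, []⟩ [] with
  | some x => S.decision (U.shape r.cls fun f => (encGam f).foldl S.snoc S.nil) (r.branchValue x)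
  | none => true

theorem StackRepr.exists_reaches_clean (hr : r.Compatible) (encGam : Gam → List Bool)
    (U : Capability Sig Gam) (hU : U.path.DescendantFree) (op : Op) (o : Bool) :
    ∃ c, Reaches S ⟨⟨.start, op, o⟩, U.tokens r.enc encGam, [], [], [], []⟩ c ∧
      c.state.pc = .cleanInp (r.answer encGam U) ∧ c.out = [] := by
  have key : ∀ (op : Op) (p : Path Sig) (s : List Token) (b : Op × Option (TestShape C)),
      p.DescendantFree →
      (∀ o x, Reaches S ⟨⟨.unwind x, op, o⟩, s, [], [], [], []⟩
        ⟨⟨.cleanInp (S.decision b x), op, o⟩, [], [], [], [], []⟩) →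
      ∃ c, Reaches S ⟨⟨.init, op, false⟩, p.tokens r.enc ++ s, [], [], [], []⟩ c ∧
        c.state.pc = .cleanInp (match p.exec ⟨none, []⟩ [] with
          | some x => S.decision b (r.branchValue x)
          | none => true) ∧ c.out = [] := by
    intro op p s b hp hb
    have h0 : Reaches S ⟨⟨.init, op, false⟩, p.tokens r.enc ++ s, [], [], [], []⟩
        ⟨⟨.readPath, op, false⟩, p.tokens r.enc ++ s, [], r.push ⟨none, []⟩ [], [], []⟩ := by
      refine .step .refl ?_
      simp only [StackRepr.push, r.val_nil]
      rfl
    have h := (r.yields_path hr op p hp ⟨none, []⟩ [] s [] (.inl rfl)).of_reaches h0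
    cases hx : p.exec ⟨none, []⟩ [] with
    | none =>
      rw [hx] at h
      exact h
    | some x =>
      rw [hx] at h
      exact ⟨_, Reaches.trans h ((r.reaches_finish op _ s x).trans (hb _ _)), rfl, rfl⟩
  cases U with
  | insert p φ =>
    obtain ⟨c, hc, h⟩ := key .insert p (φ.tokens r.enc encGam) (.insert, some (φ.shape r.cls _)) hU
      fun o x => .step (r.reaches_readNode .insert o x encGam φ) rfl
    exact ⟨c, .step hc rfl, h⟩
  | update p φ =>
    obtain ⟨c, hc, h⟩ := key .update p (φ.tokens r.enc encGam) (.update, some (φ.shape r.cls _)) hU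
      fun o x => .step (r.reaches_readNode .update o x encGam φ) rfl
    exact ⟨c, .step hc rfl, h⟩
  | delete p =>
    obtain ⟨c, hc, h⟩ := key .delete p [] (.delete, none) hU fun o x => .step .refl rfl
    rw [List.append_nil] at hc
    exact ⟨c, .step hc rfl, h⟩

/-- A halting configuration in the sense of `Turing.haltList` has all stacks empty except for the
output, so everything left over is erased. -/
theorem reaches_halted (S : Algebra C A) (op : Op) (o b : Bool) (inp : List Token)
    (todo : List TodoSym) (nodes : List (NodeSym C A)) (tmp : List Bool) :
    Reaches S ⟨⟨.cleanInp b, op, o⟩, inp, todo, nodes, tmp, []⟩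
      ⟨⟨.halted, op, o⟩, [], [], [], [], [b]⟩ := by
  have h1 : Reaches S ⟨⟨.cleanInp b, op, o⟩, inp, todo, nodes, tmp, []⟩
      ⟨⟨.cleanTodo b, op, o⟩, [], todo, nodes, tmp, []⟩ := by
    induction inp with
    | nil => exact .step .refl rfl
    | cons _ _ ih => exact ih.step rfl
  have h2 : Reaches S ⟨⟨.cleanTodo b, op, o⟩, [], todo, nodes, tmp, []⟩
      ⟨⟨.cleanNodes b, op, o⟩, [], [], nodes, tmp, []⟩ := by
    clear h1
    induction todo with
    | nil => exact .step .refl rfl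
    | cons _ _ ih => exact ih.step rfl
  have h3 : Reaches S ⟨⟨.cleanNodes b, op, o⟩, [], [], nodes, tmp, []⟩
      ⟨⟨.cleanTmp b, op, o⟩, [], [], [], tmp, []⟩ := by
    clear h1 h2
    induction nodes with
    | nil => exact .step .refl rfl
    | cons _ _ ih => exact ih.step rfl
  have h4 : Reaches S ⟨⟨.cleanTmp b, op, o⟩, [], [], [], tmp, []⟩
      ⟨⟨.output b, op, o⟩, [], [], [], [], []⟩ := by
    clear h1 h2 h3
    induction tmp with
    | nil => exact .step .refl rfl
    | cons _ _ ih => exact ih.step rfl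
  exact h1.trans (h2.trans (h3.trans (h4.trans (.step .refl rfl))))

theorem StackRepr.exists_reaches_halted (hr : r.Compatible) (encGam : Gam → List Bool)
    (U : Capability Sig Gam) (hU : U.path.DescendantFree) (op : Op) (o : Bool) :
    ∃ op' o', Reaches S ⟨⟨.start, op, o⟩, U.tokens r.enc encGam, [], [], [], []⟩
      ⟨⟨.halted, op', o'⟩, [], [], [], [], [r.answer encGam U]⟩ := by
  obtain ⟨⟨⟨pc, op', o'⟩, inp, todo, nodes, tmp, out⟩, h, h', h''⟩ :=
    r.exists_reaches_clean hr encGam U hU op o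
  simp only at h' h''
  subst h' h''
  exact ⟨op', o', h.trans (reaches_halted S op' o' _ inp todo nodes tmp)⟩

end

/-! ### Compilation to a Turing machine -/

inductive StackName : Type
  | inp
  | todo
  | nodes
  | tmp
  | out
  deriving DecidableEq

instance : Fintype StackName :=
  ⟨{.inp, .todo, .nodes, .tmp, .out}, by rintro ⟨⟩ <;> simp⟩

section

variable {C A : Type}

def StackName.Alphabet (C A : Type) : StackName → Type
  | .inp => Token
  | .todo => TodoSym
  | .nodes => NodeSym C A
  | .tmp => Bool
  | .out => Bool

def State.initial : State C A :=
  ⟨.start, .delete, false⟩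

/-- The state after an instruction is kept in the variable of the machine, and is its next label. -/
def Instr.stmt : Instr C A → Turing.TM2.Stmt (StackName.Alphabet C A) (State C A) (State C A)
  | .popInp f => .pop .inp (fun _ x => f x) (.goto fun s => s)
  | .popTodo f => .pop .todo (fun _ x => f x) (.goto fun s => s)
  | .popNodes f => .pop .nodes (fun _ x => f x) (.goto fun s => s)
  | .popTmp f => .pop .tmp (fun _ x => f x) (.goto fun s => s)
  | .pushTodo x s => .push .todo (fun _ => x) (.goto fun _ => s)
  | .pushNodes x s => .push .nodes (fun _ => x) (.goto fun _ => s)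
  | .pushTmp x s => .push .tmp (fun _ => x) (.goto fun _ => s)
  | .pushOut x s => .push .out (fun _ => x) (.goto fun _ => s)
  -- `Turing.haltList` also demands the initial value of the variable.
  | .halt => .load (fun _ => .initial) .halt

/-- The Turing machine. The alphabets of all its stacks are finite, as `C` and `A` are. -/
noncomputable def machine (S : Algebra C A) [Finite C] [Finite A] : Turing.FinTM2 where
  K := StackName
  k₀ := .inp
  k₁ := .out
  Γ := StackName.Alphabet C A
  Λ := State C A
  main := .initial
  ΛFin := Fintype.ofFinite _
  σ := State C A
  initialState := .initial
  σFin := Fintype.ofFinite _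
  Γk₀Fin := inferInstanceAs (Fintype Token)
  m s := (instr S s).stmt

def Conf.stacks (c : Conf C A) : ∀ k, List (StackName.Alphabet C A k)
  | .inp => c.inp
  | .todo => c.todo
  | .nodes => c.nodes
  | .tmp => c.tmp
  | .out => c.out

variable (S : Algebra C A) [Finite C] [Finite A]

def Conf.toTM (c : Conf C A) (v : State C A) : (machine S).Cfg :=
  (⟨some c.state, v, c.stacks⟩ :
    Turing.TM2.Cfg (StackName.Alphabet C A) (State C A) (State C A))

/-- The variable holds the current state only after a pop; a push leaves it stale. It is never
consulted before being overwritten, hence the arbitrary `v`. -/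
theorem Conf.step_toTM {c c' : Conf C A} (h : c.step S = some c') (v : State C A) :
    ∃ v', (machine S).step (c.toTM S v) = some (c'.toTM S v') := by
  have aux : ∀ (s : State C A) (v : State C A) (st st' : ∀ k, List (StackName.Alphabet C A k)),
      st = st' → (⟨some s, v, st⟩ :
        Turing.TM2.Cfg (StackName.Alphabet C A) (State C A) (State C A)) = ⟨some s, v, st'⟩ := by
    rintro s v st _ rfl
    rfl
  have hm : (machine S).step (c.toTM S v) =
      some (Turing.TM2.stepAux (instr S c.state).stmt v c.stacks) := rfl
  rw [hm]
  unfold Conf.step at h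
  generalize instr S c.state = i at h
  cases i <;> simp only [Option.some.injEq, reduceCtorEq] at h <;> subst h <;>
    refine ⟨_, congrArg some (aux _ _ _ _ ?_)⟩ <;> funext k <;> cases k <;> rfl

theorem Reaches.toTM {c c' : Conf C A} (h : Reaches S c c') :
    ∃ n, n + c'.potential ≤ c.potential ∧ ∀ v, ∃ v',
      (flip bind (machine S).step)^[n] (some (c.toTM S v)) = some (c'.toTM S v') := by
  induction h using Relation.ReflTransGen.head_induction_on with
  | refl => exact ⟨0, by simp, fun v => ⟨v, rfl⟩⟩
  | head h _ ih =>
    obtain ⟨n, hn, ih⟩ := ih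
    refine ⟨n + 1, by have := Conf.potential_lt_of_step S h; omega, fun v => ?_⟩
    obtain ⟨v', hv'⟩ := Conf.step_toTM S h v
    obtain ⟨v'', hv''⟩ := ih v'
    refine ⟨v'', ?_⟩
    rw [Function.iterate_succ_apply, ← hv'']
    exact congrArg _ hv'

/-- The initial potential is `300 * w.length + 6`, the final one is zero, and one further step
halts. -/
theorem outputsInTime {w : List Token} {b : Bool} {op : Op} {o : Bool}
    (h : Reaches S ⟨.initial, w, [], [], [], []⟩ ⟨⟨.halted, op, o⟩, [], [], [], [], [b]⟩) :
    Nonempty (Turing.TM2OutputsInTime (machine S) w (some [b]) (300 * w.length + 7)) := by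
  obtain ⟨n, hn, hv⟩ := h.toTM
  obtain ⟨v', hv'⟩ := hv .initial
  have h1 : Turing.initList (machine S) w =
      Conf.toTM S ⟨.initial, w, [], [], [], []⟩ .initial :=
    congrArg (fun st => (⟨some .initial, .initial, st⟩ :
      Turing.TM2.Cfg (StackName.Alphabet C A) (State C A) (State C A)))
      (funext fun k => by cases k <;> rfl)
  have h2 : (machine S).step (Conf.toTM S ⟨⟨.halted, op, o⟩, [], [], [], [], [b]⟩ v') =
      some (Turing.haltList (machine S) [b]) :=
    congrArg (fun st => some (⟨none, .initial, st⟩ :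
      Turing.TM2.Cfg (StackName.Alphabet C A) (State C A) (State C A)))
      (funext fun k => by cases k <;> rfl)
  refine ⟨⟨⟨n + 1, ?_⟩, ?_⟩⟩
  · rw [Function.iterate_succ_apply', h1]
    exact (congrArg _ hv').trans h2
  · simp only [Conf.potential, State.initial, Pc.rank, List.length_nil] at hn
    change n + 1 ≤ _
    omega

end

/-! ### Classes of words -/

/-- The words of length at most `N`, and one class for all longer words. -/
abbrev WordClass (N : ℕ) : Type :=
  Option {w : List Bool // w.length ≤ N}

instance (N : ℕ) : Finite (WordClass N) :=
  have : Finite {w : List Bool // w.length ≤ N} := (List.finite_length_le Bool N).to_subtype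
  inferInstance

def wordClass (N : ℕ) (w : List Bool) : WordClass N :=
  if h : w.length ≤ N then some ⟨w, h⟩ else none

/-- Makes the class computable bit by bit: an overlong word stays overlong. -/
def WordClass.snoc {N : ℕ} (c : WordClass N) (b : Bool) : WordClass N :=
  c.bind fun w => wordClass N (w.1 ++ [b])

theorem WordClass.foldl_snoc {N : ℕ} (w : List Bool) :
    ∀ u, w.foldl WordClass.snoc (wordClass N u) = wordClass N (u ++ w) := by
  induction w with
  | nil => simp
  | cons b w ih =>
    intro u
    have : (wordClass N u).snoc b = wordClass N (u ++ [b]) := by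
      by_cases h : u.length ≤ N
      · simp [wordClass, WordClass.snoc, h]
      · simp [wordClass, WordClass.snoc, h, show ¬ u.length + 1 ≤ N by omega]
    rw [List.foldl_cons, this, ih, List.append_assoc, List.singleton_append]

/-- Words of length at most `N` are alone in their class, and all names in `K` are of this kind. -/
theorem separates_wordClass {α : Type} {enc : α → List Bool} (henc : Function.Injective enc)
    {N : ℕ} {K : Set α} (hK : ∀ k ∈ K, (enc k).length ≤ N) :
    Separates (fun l => wordClass N (enc l)) K := by
  have key : ∀ l l', wordClass N (enc l) = wordClass N (enc l') → ∀ k ∈ K, l = k → l' = k := by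
    rintro l l' h _ hk rfl
    by_cases h' : (enc l').length ≤ N
    · simp only [wordClass, hK l hk, h', dite_true, Option.some.injEq, Subtype.mk.injEq] at h
      exact henc h.symm
    · simp [wordClass, hK l hk, h'] at h
  exact fun l l' h k hk => ⟨key l l' h k hk, key l' l h.symm k hk⟩

theorem exists_length_le {α : Type} (enc : α → List Bool) {K : Set α} (hK : K.Finite) :
    ∃ N, ∀ k ∈ K, (enc k).length ≤ N := by
  obtain ⟨N, hN⟩ := (hK.image fun k => (enc k).length).bddAbove
  exact ⟨N, fun k hk => hN ⟨k, hk, rfl⟩⟩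

-- The finite algebra of a policy

section

variable {Sig Gam : Type}

open Classical in
/-- The operations of the machine that decides static allowance for the policy `P`. -/
noncomputable def policyAlgebra (D : Type) (P : Policy Sig Gam) (Φ : Set (Form Sig)) (N : ℕ)
    (enc : Sig → List Bool) (encGam : Gam → List Bool) :
    Algebra (WordClass N) (Set (Set Φ)) where
  empty := reqTypes Gam D Φ []
  close := closeTypes Φ (fun l => wordClass N (enc l)) False
  closeMarked := closeTypes Φ (fun l => wordClass N (enc l)) True
  add := Set.image2 (· ∪ ·)
  nil := wordClass N []
  snoc := WordClass.snoc
  decision s R := decide (P.Decision D Φ (fun l => wordClass N (enc l))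
    (fun f => wordClass N (encGam f)) s R)

/-- The stacks of that machine represent requirements by their types. -/
def policyRepr (D : Type) (P : Policy Sig Gam) (Φ : Set (Form Sig)) (N : ℕ)
    {enc : Sig → List Bool} (henc : Function.Injective enc) (encGam : Gam → List Bool) :
    StackRepr Sig (WordClass N) (Set (Set Φ)) (policyAlgebra D P Φ N enc encGam) where
  enc := enc
  enc_injective := henc
  val := reqTypes Gam D Φ
  val_nil := rfl

variable {D : Type} (P : Policy Sig Gam) {Φ : Set (Form Sig)} {N : ℕ} {enc : Sig → List Bool}
  (henc : Function.Injective enc) (encGam : Gam → List Bool)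

theorem policyRepr_cls : (policyRepr D P Φ N henc encGam).cls = fun l => wordClass N (enc l) :=
  funext fun l => WordClass.foldl_snoc (enc l) []

/-- This is the compositionality of types: `reqTypes_cons` gives the addition, and
`formTypes_frame`, up to classes of names, the closing of a node. -/
theorem compatible_policyRepr (hΦ : FormsClosed Φ)
    (hN : Separates (fun l => wordClass N (enc l)) (formNames Φ)) :
    (policyRepr D P Φ N henc encGam).Compatible := by
  intro f gs
  rw [policyRepr_cls]
  exact (reqTypes_cons Φ _ gs).trans (congrArg _ ((formTypes_frame hΦ f).trans
    (closeTypes_frame hΦ hN False f _).symm))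

theorem unwind_policyRepr (fs : List (Frame Sig)) : ∀ R : Set (Set Φ),
    (policyRepr D P Φ N henc encGam).unwind R fs =
      branchTypes Gam D Φ (fun l => wordClass N (enc l)) R fs := by
  induction fs with
  | nil => exact fun _ => rfl
  | cons g gs ih =>
    intro R
    rw [StackRepr.unwind, ih, policyRepr_cls]
    rfl

theorem answer_policyRepr (hΦ : FormsClosed Φ)
    (hN : Separates (fun l => wordClass N (enc l)) (formNames Φ))
    (hP : ∀ C ∈ P.capabilities, C.path.form .mark ∈ Φ)
    (hS : Separates (fun l => wordClass N (enc l)) P.names)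
    (hG : Separates (fun f => wordClass N (encGam f)) P.attrs)
    (U : Capability Sig Gam) (hU : U.path.DescendantFree) :
    (policyRepr D P Φ N henc encGam).answer encGam U = true ↔ P.StaticallyAllows D U := by
  rw [P.staticallyAllows_iff_decision hP hS hG, markedTypes_path Φ _ hU, StackRepr.answer]
  cases hx : U.path.exec ⟨none, []⟩ [] with
  -- The path selects nothing in any tree, so there are no marked types and acceptance is correct.
  | none => simp [Policy.Decision]
  | some x =>
    have hm := List.forall_mem_cons.1 (U.path.markFree_exec hx (by simp [Frame.MarkFree]))
    have hv : (policyRepr D P Φ N henc encGam).branchValue x =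
        markedTypes Gam D Φ (branchForm x.2 (x.1.form .mark)) := by
      rw [markedTypes_branchForm hΦ hN x.2 hm.2 (Form.Marked.frame (φ := .mark) trivial x.1),
        markedTypes_frame_mark hΦ, ← closeTypes_frame hΦ hN, StackRepr.branchValue,
        unwind_policyRepr, policyRepr_cls]
      rfl
    have hc : (fun f => (encGam f).foldl (policyAlgebra D P Φ N enc encGam).snoc
        (policyAlgebra D P Φ N enc encGam).nil) = fun f => wordClass N (encGam f) :=
      funext fun f => WordClass.foldl_snoc (encGam f) []
    simp only [hv, hc, policyRepr_cls, Option.mem_some_iff, exists_eq_left']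
    classical exact decide_eq_true_iff

end

theorem decidableInPolyTime_staticallyAllows {Sig Gam D : Type}
    (eSig : Computability.Encoding Sig Bool) (eGam : Computability.Encoding Gam Bool)
    (P : Policy Sig Gam) :
    DecidableInPolyTime (capabilityEncoding eSig eGam)
      (fun U : ChildCapability Sig Gam => P.StaticallyAllows D U.1) := by
  obtain ⟨Φ, hP, hfin, hΦ⟩ := exists_finite_formsClosed _
    (P.finite_capabilities.image fun C => C.path.form .mark)
  have hnames : (formNames Φ).Finite :=
    Set.Finite.preimage (f := fun k => Form.test (.name k))
      (fun _ _ _ _ h => by simpa using h) hfin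
  -- One bound for the element names in the formulas of `Φ` and in the node tests of the policy;
  -- their classes must separate both.
  obtain ⟨N1, hN1⟩ := exists_length_le eSig.encode (hnames.union P.finite_names)
  obtain ⟨N2, hN2⟩ := exists_length_le eGam.encode P.finite_attrs
  have hS := separates_wordClass eSig.encode_injective (N := max N1 N2)
    fun k hk => (hN1 k hk).trans (le_max_left _ _)
  have hG := separates_wordClass eGam.encode_injective (N := max N1 N2)
    fun k hk => (hN2 k hk).trans (le_max_right _ _)
  have hN := fun l l' h k hk => hS l l' h k (.inl hk)
  have : Finite Φ := hfin
  let r := policyRepr D P Φ (max N1 N2) eSig.encode_injective eGam.encode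
  refine ⟨fun U => r.answer eGam.encode U.1, fun U => answer_policyRepr P eSig.encode_injective
    eGam.encode hΦ hN (fun C hC => hP ⟨C, hC, rfl⟩) (fun l l' h k hk => hS l l' h k (.inr hk)) hG
    U.1 U.2, ⟨?_⟩⟩
  refine
    { tm := machine (policyAlgebra D P Φ (max N1 N2) eSig.encode eGam.encode)
      inputAlphabet := Equiv.refl Token
      outputAlphabet := Equiv.refl Bool
      time := 300 * Polynomial.X + 7
      outputsFun := fun U => Classical.choice ?_ }
  obtain ⟨op, o, h⟩ := r.exists_reaches_halted (compatible_policyRepr P _ _ hΦ hN) eGam.encode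
    U.1 U.2 .delete false
  have hmap : ∀ (α : Type) (w : List α), w.map (Equiv.refl α).invFun = w := fun _ w => w.map_id
  refine (congrArg₂ (fun w w' => Nonempty (Turing.TM2OutputsInTime (machine _) w (some w') _))
    (hmap Token _) (hmap Bool _)).mpr ?_
  rw [Polynomial.eval_add, Polynomial.eval_mul, Polynomial.eval_X, Polynomial.eval_ofNat,
    Polynomial.eval_ofNat]
  exact outputsInTime _ h

end XPathPolicy

theorem mainTheorem5 {Sig Gam D : Type} [Infinite Sig] [Infinite Gam] [Infinite D]
    (eSig : Computability.Encoding Sig Bool) (eGam : Computability.Encoding Gam Bool)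
    (P : XPathPolicy.Policy Sig Gam) :
    XPathPolicy.DecidableInPolyTime (XPathPolicy.capabilityEncoding eSig eGam)
      (fun U : XPathPolicy.ChildCapability Sig Gam => P.StaticallyAllows D U.1) :=
  XPathPolicy.decidableInPolyTime_staticallyAllows eSig eGam P
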